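/- Let $d\ge 1$ and let $\mu$ be a locally finite measure on $\mathbb{R}^d$ with density $f:\mathbb{R}^d\to[0,\infty)$ with respect to Lebesgue measure. Let $W\subset\mathbb{R}^d$ be a compact set with $\mu(W)=1$, and assume that there is a bounded open set $A\supset W$ with $\inf_{x\in A} f(x)>0$ and $\sup_{x\in A} f(x)<\infty$. For every $t>0$ let $\eta_t$ be a Poisson process on $\mathbb{R}^d$ with intensity measure $t\mu$. For a locally finite counting measure $\nu$ on $\mathbb{R}^d$ and $x\in\mathbb{R}^d$ let $$N(x,\nu)=\{y\in\mathbb{R}^d : \|x-y\|\le\|y-x'\| \text{ for all } x'\in\nu \text{ with } x'\neq x\}$$ be the Voronoi cell with nucleus $x$ generated by $\nu+\delta_x$, and let $$c(x,\nu)=\sup\{R\ge 0 : \mathbf{B}(x,R)\subset N(x,\nu)\}\in[0,\infty]$$ be its inradius, where $\|\cdot\|$ is the Euclidean norm and $\mathbf{B}(x,r)$ is the open ball with center $x$ and radius $r$ (with $\mathbf{B}(x,\infty)=\mathbb{R}^d$). Then, for every $u\in\mathbb{R}$, $$\lim_{t\to\infty}\mathbb{P}\Big(\max_{x\in\eta_t\cap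 W}\big(t\,\mu(\mathbf{B}(x,2c(x,\eta_t)))-\log t\big)\le u\Big)=e^{-e^{-u}}.$$ Moreover, if $f$ is H\"older continuous, i.e. if there are $b>0$ and $C>0$ with $|f(x)-f(y)|\le C\|x-y\|^b$ for all $x,y\in\mathbb{R}^d$, then, for every $u\in\mathbb{R}$, $$\lim_{t\to\infty}\mathbb{P}\Big(\max_{x\in\eta_t\cap W}\big(2^d\,t\,\mu(\mathbf{B}(x,c(x,\eta_t)))-\log t\big)\le u\Big)=e^{-e^{-u}}.$$ Here the maximum over the empty set is $-\infty$. -/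

import Mathlib

open MeasureTheory ProbabilityTheory Filter Topology
open scoped ENNReal NNReal

/-- Locally finite counting measures: locally finite measures whose values on measurable sets lie
in `{0, 1, 2, …, ∞}`. -/
structure IsLocFinCounting {E : Type*} [TopologicalSpace E] [MeasurableSpace E]
    (ν : Measure E) : Prop where
  locallyFinite : IsLocallyFiniteMeasure ν
  counting : ∀ B : Set E, MeasurableSet B → ∃ n : ℕ∞, ν B = (n : ℝ≥0∞)

/-- `η` is a Poisson process with intensity measure `Λ`: a random locally finite counting measure
(for the `σ`-field generated by the evaluations `ν ↦ ν B`) such that `η(B)` is Poisson distributed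
with parameter `Λ(B)` whenever `Λ(B) < ∞`, and such that the numbers of points in finitely many
pairwise disjoint sets are independent. -/
structure IsPoissonProcess {Ω E : Type*} [MeasurableSpace Ω] [TopologicalSpace E]
    [MeasurableSpace E] (P : Measure Ω) (Λ : Measure E) (η : Ω → Measure E) : Prop where
  measurable : Measurable η
  counting : ∀ ω, IsLocFinCounting (η ω)
  poisson : ∀ B : Set E, MeasurableSet B → Λ B ≠ ∞ →
    P.map (fun ω => η ω B) =
      (poissonMeasure (Λ B).toNNReal).map (fun k : ℕ => (k : ℝ≥0∞))
  indep : ∀ (n : ℕ) (B : Fin n → Set E), (∀ i, MeasurableSet (B i)) →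
    (Pairwise fun i j => Disjoint (B i) (B j)) →
    iIndepFun (fun i ω => η ω (B i)) P

/-- The points (atoms) of a counting measure; `x ∈ points ν` is what is usually written
`x ∈ ν`. -/
def points {E : Type*} [MeasurableSpace E] (ν : Measure E) : Set E :=
  {x | ν {x} ≠ 0}

/-- The Voronoi cell with nucleus `x` generated by `ν + δ_x`. -/
def voronoiCell {d : ℕ} (x : EuclideanSpace ℝ (Fin d))
    (ν : Measure (EuclideanSpace ℝ (Fin d))) : Set (EuclideanSpace ℝ (Fin d)) :=
  {y | ∀ x' ∈ points ν, x' ≠ x → ‖x - y‖ ≤ ‖y - x'‖}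

/-- The inradius of the Voronoi cell with nucleus `x`. It is `∞` if the cell is the whole space,
that is, if `ν` has no point other than `x`. -/
noncomputable def inradius {d : ℕ} (x : EuclideanSpace ℝ (Fin d))
    (ν : Measure (EuclideanSpace ℝ (Fin d))) : ℝ≥0∞ :=
  sSup {r : ℝ≥0∞ | ∃ R : ℝ≥0, r = R ∧ Metric.ball x (R : ℝ) ⊆ voronoiCell x ν}

/-- The maximum over the nuclei `x ∈ ν ∩ W` of `t μ(B(x, 2 c(x, ν))) - log t`, in the extended
reals. If `W` is compact and `ν` is locally finite, then `ν ∩ W` is finite and the supremum is a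
maximum (equal to `-∞` if there are no nuclei in `W`). -/
noncomputable def maxInradius {d : ℕ} (μ : Measure (EuclideanSpace ℝ (Fin d)))
    (W : Set (EuclideanSpace ℝ (Fin d))) (t : ℝ) (ν : Measure (EuclideanSpace ℝ (Fin d))) :
    EReal :=
  ⨆ x ∈ points ν ∩ W,
    ((ENNReal.ofReal t * μ (Metric.eball x (2 * inradius x ν)) : ℝ≥0∞) : EReal)
      - (Real.log t : EReal)

/-- The maximum over the nuclei `x ∈ ν ∩ W` of `2 ^ d t μ(B(x, c(x, ν))) - log t`, in the extended
reals, with the same conventions. -/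
noncomputable def maxInradiusHat {d : ℕ} (μ : Measure (EuclideanSpace ℝ (Fin d)))
    (W : Set (EuclideanSpace ℝ (Fin d))) (t : ℝ) (ν : Measure (EuclideanSpace ℝ (Fin d))) :
    EReal :=
  ⨆ x ∈ points ν ∩ W,
    ((2 ^ d * ENNReal.ofReal t * μ (Metric.eball x (inradius x ν)) : ℝ≥0∞) : EReal)
      - (Real.log t : EReal)

/-!
The ball `B(x, 2 c(x, η))` has the distance from `x` to the nearest other point of `η` as its
radius (`inradius_le_half_dist`, `half_le_inradius`). Put `l = log t + u` and let `r(x)` be the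
radius at which the ball around `x` has `μ`-measure `l / t` (`massRadius`). The maximum is then at
most `u` essentially when no point of `η ∩ W` is isolated, that is, when each of them has another
point within distance `r(x)` (`closePairsEvent`). The expected number of isolated points in `W` is
`t * μ W * exp (-l) = exp (-u)`, so it has to be shown that their number is asymptotically Poisson,
as far as the probability of the value `0` is concerned.

Instead of Palm calculus, a discretisation is used. A neighbourhood of `W` is cut into cells that
are so small that, up to a negligible probability, none of those in `W` contains two points. The
events that the single cells are occupied are independent, and an isolated point corresponds to an
occupied cell such that all other cells within distance about `r` are vacant (`isolatedEvent`).
Such events are independent for cells far apart, and the Chen–Stein method (`chenStein_none`)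
compares the probability that none of them occurs with `exp (-λ)`, where `λ` is the expected
number. There are two error terms. The sum of `p i * p j` over neighbouring cells is of order
`l * exp (-l)`, since a ball of radius comparable to `r` has expected mass of order `l`. For two
distinct neighbouring cells to be isolated simultaneously, neither may lie in the vacant ball
around the other, so the two balls together have a mass of at least `(1 + c) * l`
(`le_sum_nearCells_union`), and these probabilities sum to order `l * exp (-c * l)`. The resulting
bound is `abs_measureReal_closePairsEvent_sub_le`.

Both limits follow from `tendsto_measureReal_iSup_inradius_le`, which only requires that the
functional of the inradius equal `log t + u + o(1)` at half the critical radius. For the first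
functional there is no error. For the second one, Hölder continuity makes `2 ^ d * μ(B(x, r / 2))`
differ from `μ(B(x, r))` by `O(r ^ (d + β))`, and `t * r ^ (d + β)` is of order
`l * (l / t) ^ (β / d)`.
-/

/-! ### Poisson approximation for dissociated events -/

/-- The solution `k ↦ g (k + 1)` of the Stein equation
`l * g (k + 1) - k * g k = 1_{k = 0} - exp (-l)` of the Poisson law with parameter `l` for the
event `{0}`. -/
noncomputable def steinSol (l : ℝ) (k : ℕ) : ℝ := ∫ s in (0 : ℝ)..1, Real.exp (-l * s) * s ^ k

theorem intervalIntegrable_steinSol (l : ℝ) (k : ℕ) :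
    IntervalIntegrable (fun s : ℝ => Real.exp (-l * s) * s ^ k) volume 0 1 :=
  Continuous.intervalIntegrable (by fun_prop) _ _

theorem steinSol_equation (l : ℝ) (k : ℕ) :
    l * steinSol l k - k * steinSol l (k - 1) = (if k = 0 then 1 else 0) - Real.exp (-l) := by
  have hd : ∀ s ∈ Set.uIcc (0 : ℝ) 1, HasDerivAt (fun s : ℝ => Real.exp (-l * s) * s ^ k)
      (k * (Real.exp (-l * s) * s ^ (k - 1)) - l * (Real.exp (-l * s) * s ^ k)) s := by
    intro s _
    have h1 : HasDerivAt (fun s : ℝ => Real.exp (-l * s)) (Real.exp (-l * s) * (-l)) s := by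
      simpa using ((hasDerivAt_id s).const_mul (-l)).exp
    refine (h1.mul (hasDerivAt_pow k s)).congr_deriv ?_
    ring
  have := intervalIntegral.integral_eq_sub_of_hasDerivAt hd
    (Continuous.intervalIntegrable (by fun_prop) _ _)
  rw [intervalIntegral.integral_sub ((intervalIntegrable_steinSol l (k - 1)).const_mul _)
    ((intervalIntegrable_steinSol l k).const_mul _), intervalIntegral.integral_const_mul,
    intervalIntegral.integral_const_mul] at this
  unfold steinSol
  rcases Nat.eq_zero_or_pos k with rfl | hk
  · simp at this ⊢
    linarith
  · simp [hk.ne'] at this ⊢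
    linarith

/-- Bound `1` for the increments of the Stein solution: they are integrals over `[0, 1]` of
`-exp (-l * s) * s ^ k * (1 - s)`. -/
theorem abs_steinSol_succ_sub_le {l : ℝ} (hl : 0 ≤ l) (k : ℕ) :
    |steinSol l (k + 1) - steinSol l k| ≤ 1 := by
  unfold steinSol
  rw [← intervalIntegral.integral_sub (intervalIntegrable_steinSol l _)
    (intervalIntegrable_steinSol l _)]
  have := intervalIntegral.norm_integral_le_of_norm_le_const (a := (0 : ℝ)) (b := 1) (C := 1)
    (f := fun s : ℝ => Real.exp (-l * s) * s ^ (k + 1) - Real.exp (-l * s) * s ^ k) ?_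
  · simpa using this
  · intro s hs
    rw [Set.uIoc_of_le zero_le_one] at hs
    have h1 : Real.exp (-l * s) ≤ 1 := Real.exp_le_one_iff.2 (by nlinarith [hs.1])
    have h2 : s ^ k ≤ 1 := pow_le_one₀ hs.1.le hs.2
    have h3 : 0 ≤ s ^ k := pow_nonneg hs.1.le k
    have e : Real.exp (-l * s) * s ^ (k + 1) - Real.exp (-l * s) * s ^ k
        = -(Real.exp (-l * s) * s ^ k * (1 - s)) := by ring
    rw [e, norm_neg, Real.norm_eq_abs, abs_of_nonneg
      (mul_nonneg (mul_nonneg (Real.exp_pos _).le h3) (by linarith [hs.2]))]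
    exact mul_le_one₀ (mul_le_one₀ h1 h3 h2) (by linarith [hs.2]) (by linarith [hs.1])

theorem abs_steinSol_add_sub_le {l : ℝ} (hl : 0 ≤ l) (k n : ℕ) :
    |steinSol l (k + n) - steinSol l k| ≤ n := by
  induction n with
  | zero => simp
  | succ n ih =>
    have := abs_steinSol_succ_sub_le hl (k + n)
    push_cast
    calc |steinSol l (k + (n + 1)) - steinSol l k|
        = |(steinSol l (k + n + 1) - steinSol l (k + n)) +
            (steinSol l (k + n) - steinSol l k)| := by
          congr 1; rw [← add_assoc]; ring
      _ ≤ _ := abs_add_le _ _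
      _ ≤ _ := by linarith

/-- The number of events `G j`, `j ∈ S`, that occur. -/
noncomputable def eventCount {ι Ω : Type*} (G : ι → Set Ω) (S : Finset ι) (ω : Ω) : ℕ :=
  ∑ j ∈ S, (G j).indicator 1 ω

theorem natCast_indicator_one {Ω : Type*} (A : Set Ω) (ω : Ω) :
    ((A.indicator (1 : Ω → ℕ) ω : ℕ) : ℝ) = A.indicator (fun _ => (1 : ℝ)) ω := by
  by_cases h : ω ∈ A <;> simp [h]

theorem measurable_eventCount {ι Ω : Type*} {m : MeasurableSpace Ω} {G : ι → Set Ω} {S : Finset ι}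
    (hG : ∀ j ∈ S, MeasurableSet (G j)) : Measurable (eventCount G S) := by
  unfold eventCount
  exact Finset.measurable_sum _ fun j hj => measurable_const.indicator (hG j hj)

theorem eventCount_le_card {ι Ω : Type*} (G : ι → Set Ω) (S : Finset ι) (ω : Ω) :
    eventCount G S ω ≤ S.card := by
  unfold eventCount
  refine (Finset.sum_le_card_nsmul S _ 1 fun j _ => ?_).trans (by simp)
  exact Set.indicator_le_self' (by simp) ω

theorem eventCount_eq_zero {ι Ω : Type*} {G : ι → Set Ω} {S : Finset ι} {ω : Ω} :
    eventCount G S ω = 0 ↔ ∀ j ∈ S, ω ∉ G j := by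
  simp [eventCount]

theorem integrable_comp_eventCount {ι Ω : Type*} [MeasurableSpace Ω] (P : Measure Ω)
    [IsFiniteMeasure P] {G : ι → Set Ω} {S : Finset ι} (hG : ∀ j ∈ S, MeasurableSet (G j))
    (φ : ℕ → ℝ) : Integrable (fun ω => φ (eventCount G S ω)) P := by
  refine Integrable.of_bound
    ((measurable_from_nat (f := φ)).comp (measurable_eventCount hG)).aestronglyMeasurable
    (∑ k ∈ Finset.range (S.card + 1), |φ k|) (ae_of_all _ fun ω => ?_)
  exact Finset.single_le_sum (f := fun k => |φ k|) (fun _ _ => abs_nonneg _)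
    (Finset.mem_range.2 (Nat.lt_succ_of_le (eventCount_le_card G S ω)))

theorem integral_eventCount {ι Ω : Type*} [MeasurableSpace Ω] (P : Measure Ω)
    [IsFiniteMeasure P] {G : ι → Set Ω} {S : Finset ι} (hG : ∀ j ∈ S, MeasurableSet (G j)) :
    ∫ ω, (eventCount G S ω : ℝ) ∂P = ∑ j ∈ S, P.real (G j) := by
  have : ∀ ω, (eventCount G S ω : ℝ) = ∑ j ∈ S, (G j).indicator (fun _ => (1 : ℝ)) ω := by
    intro ω
    simp only [eventCount, Nat.cast_sum, natCast_indicator_one]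
  simp_rw [this]
  rw [integral_finsetSum _ fun j hj => (integrable_const (1 : ℝ)).indicator (hG j hj)]
  refine Finset.sum_congr rfl fun j hj => ?_
  rw [integral_indicator_const _ (hG j hj)]
  simp

/-- The Chen–Stein bound for the probability that none of finitely many events occurs, when each
event `G i` is independent of the number of events outside a neighbourhood `B i` of `i`. -/
theorem chenStein_none {ι Ω : Type*} [DecidableEq ι] [MeasurableSpace Ω] (P : Measure Ω)
    [IsProbabilityMeasure P] (V : Finset ι) (G : ι → Set Ω) (hG : ∀ i, MeasurableSet (G i))
    (B : ι → Finset ι) (hBV : ∀ i ∈ V, B i ⊆ V) (hiB : ∀ i ∈ V, i ∈ B i)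
    (hind : ∀ i ∈ V, IndepFun ((G i).indicator fun _ => (1 : ℝ)) (eventCount G (V \ B i)) P) :
    |P.real {ω | ∀ i ∈ V, ω ∉ G i} - Real.exp (-∑ i ∈ V, P.real (G i))| ≤
      (∑ i ∈ V, ∑ j ∈ B i, P.real (G i) * P.real (G j)) +
        ∑ i ∈ V, ∑ j ∈ (B i).erase i, P.real (G i ∩ G j) := by
  set l : ℝ := ∑ i ∈ V, P.real (G i) with hl
  have hl0 : 0 ≤ l := Finset.sum_nonneg fun _ _ => measureReal_nonneg
  set N := eventCount G V with hN
  have hint : ∀ (S : Finset ι) (φ : ℕ → ℝ), Integrable (fun ω => φ (eventCount G S ω)) P :=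
    fun S φ => integrable_comp_eventCount P (fun j _ => hG j) φ
  have hintI : ∀ (i : ι) (S : Finset ι) (φ : ℕ → ℝ),
      Integrable (fun ω => (G i).indicator (fun _ => (1 : ℝ)) ω * φ (eventCount G S ω)) P := by
    intro i S φ
    have : (fun ω => (G i).indicator (fun _ => (1 : ℝ)) ω * φ (eventCount G S ω)) =
        (G i).indicator fun ω => φ (eventCount G S ω) := by
      ext ω; by_cases h : ω ∈ G i <;> simp [h]
    rw [this]
    exact (hint S φ).indicator (hG i)
  -- the expectation of the Stein equation
  have hstein : P.real {ω | ∀ i ∈ V, ω ∉ G i} - Real.exp (-l) =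
      ∑ i ∈ V, (P.real (G i) * ∫ ω, steinSol l (N ω) ∂P
        - ∫ ω, (G i).indicator (fun _ => (1 : ℝ)) ω * steinSol l (N ω - 1) ∂P) := by
    have hset : MeasurableSet {ω | ∀ i ∈ V, ω ∉ G i} := by
      have : {ω | ∀ i ∈ V, ω ∉ G i} = ⋂ i ∈ V, (G i)ᶜ := by ext; simp
      rw [this]
      exact Finset.measurableSet_biInter _ fun i _ => (hG i).compl
    have h1 : P.real {ω | ∀ i ∈ V, ω ∉ G i} - Real.exp (-l) =
        ∫ ω, (l * steinSol l (N ω) - N ω * steinSol l (N ω - 1)) ∂P := by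
      have : ∀ ω, (l * steinSol l (N ω) - N ω * steinSol l (N ω - 1)) =
          ({ω | ∀ i ∈ V, ω ∉ G i}.indicator (fun _ => (1 : ℝ)) ω) - Real.exp (-l) := by
        intro ω
        rw [steinSol_equation]
        congr 1
        by_cases h : ∀ i ∈ V, ω ∉ G i
        · rw [if_pos (eventCount_eq_zero.2 h), Set.indicator_of_mem (by exact h)]
        · rw [if_neg (fun h' => h (eventCount_eq_zero.1 h')), Set.indicator_of_notMem (by exact h)]
      simp_rw [this]
      rw [integral_sub ((integrable_const (1 : ℝ)).indicator hset) (integrable_const _),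
        integral_indicator_const _ hset]
      simp
    rw [h1, integral_sub ((hint V (steinSol l)).const_mul l)
      (hint V fun k => k * steinSol l (k - 1)), integral_const_mul, Finset.sum_sub_distrib,
      ← Finset.sum_mul]
    congr 1
    rw [← integral_finsetSum _ fun i _ => hintI i V fun k => steinSol l (k - 1)]
    refine integral_congr_ae (ae_of_all _ fun ω => ?_)
    simp only [← Finset.sum_mul]
    congr 1
    simp only [eventCount, Nat.cast_sum, natCast_indicator_one]
  -- it remains to compare `steinSol l (N - 1)` on `G i` with `steinSol l N` term by term, passing
  -- through the count outside `B i`, which is independent of `G i`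
  rw [hstein, ← Finset.sum_add_distrib]
  refine (Finset.abs_sum_le_sum_abs _ _).trans (Finset.sum_le_sum fun i hi => ?_)
  have hsplit : ∀ ω, N ω = eventCount G (V \ B i) ω + eventCount G (B i) ω := fun ω =>
    (Finset.sum_sdiff (hBV i hi)).symm
  have herase : ∀ ω, eventCount G (B i) ω =
      eventCount G ((B i).erase i) ω + (G i).indicator 1 ω := fun ω =>
    (Finset.sum_erase_add _ _ (hiB i hi)).symm
  have hprod : ∫ ω, (G i).indicator (fun _ => (1 : ℝ)) ω * steinSol l (eventCount G (V \ B i) ω) ∂P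
      = P.real (G i) * ∫ ω, steinSol l (eventCount G (V \ B i) ω) ∂P := by
    have hm : Measurable (steinSol l) := measurable_from_nat
    have h := (hind i hi).comp measurable_id hm
    have h2 := h.integral_mul_eq_mul_integral
      ((measurable_const.indicator (hG i)).aestronglyMeasurable)
      (hint _ (steinSol l)).aestronglyMeasurable
    have h3 : ∫ ω, (G i).indicator (fun _ => (1 : ℝ)) ω ∂P = P.real (G i) := by
      rw [integral_indicator_const _ (hG i)]; simp
    rw [← h3]
    exact h2
  -- leaving out the events in `B i` changes the count by the number of those that occur
  have hA : |P.real (G i) * ∫ ω, steinSol l (N ω) ∂P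
      - P.real (G i) * ∫ ω, steinSol l (eventCount G (V \ B i) ω) ∂P|
      ≤ ∑ j ∈ B i, P.real (G i) * P.real (G j) := by
    rw [← mul_sub, abs_mul, abs_of_nonneg measureReal_nonneg, ← Finset.mul_sum,
      ← integral_sub (hint V _) (hint _ _), ← integral_eventCount P fun j _ => hG j]
    refine mul_le_mul_of_nonneg_left ?_ measureReal_nonneg
    refine (abs_integral_le_integral_abs).trans (integral_mono ?_ (hint (B i) fun k => k) ?_)
    · exact ((hint V _).sub (hint _ _)).abs
    · intro ω
      change |steinSol l (N ω) - _| ≤ _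
      rw [hsplit ω]
      exact abs_steinSol_add_sub_le hl0 _ _
  -- on `G i`, the count `N - 1` exceeds the count outside `B i` by the number of the other events
  -- in `B i` that occur
  have hB : |∫ ω, (G i).indicator (fun _ => (1 : ℝ)) ω * steinSol l (eventCount G (V \ B i) ω) ∂P
      - ∫ ω, (G i).indicator (fun _ => (1 : ℝ)) ω * steinSol l (N ω - 1) ∂P|
      ≤ ∑ j ∈ (B i).erase i, P.real (G i ∩ G j) := by
    have hcap : ∑ j ∈ (B i).erase i, P.real (G i ∩ G j) =
        ∫ ω, (G i).indicator (fun _ => (1 : ℝ)) ω * (eventCount G ((B i).erase i) ω : ℝ) ∂P := by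
      rw [← integral_eventCount P (G := fun j => G i ∩ G j) fun j _ => (hG i).inter (hG j)]
      refine integral_congr_ae (ae_of_all _ fun ω => ?_)
      simp only [eventCount, Nat.cast_sum, natCast_indicator_one, Finset.mul_sum]
      refine Finset.sum_congr rfl fun j _ => ?_
      by_cases h : ω ∈ G i <;> by_cases h' : ω ∈ G j <;> simp [h, h']
    rw [hcap, ← integral_sub (hintI i _ _) (hintI i V fun k => steinSol l (k - 1))]
    refine (abs_integral_le_integral_abs).trans (integral_mono ?_ (hintI i _ fun k => k) ?_)
    · exact ((hintI i _ _).sub (hintI i V fun k => steinSol l (k - 1))).abs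
    · intro ω
      by_cases h : ω ∈ G i
      · have hN1 : N ω - 1 = eventCount G (V \ B i) ω + eventCount G ((B i).erase i) ω := by
          rw [hsplit ω, herase ω, Set.indicator_of_mem h, Pi.one_apply, ← add_assoc,
            Nat.add_sub_cancel]
        change |_ * _ - _ * steinSol l (N ω - 1)| ≤ _
        rw [hN1, abs_sub_comm]
        simp only [h, Set.indicator_of_mem, one_mul]
        exact abs_steinSol_add_sub_le hl0 _ _
      · simp [h]
  rw [← hprod] at hA
  calc _ ≤ _ := abs_sub_le _ _ _
    _ ≤ _ := add_le_add hA hB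

/-! ### Isolated occupied sites in a field of independent events -/

/-- The event that `A i` occurs but none of the events `A j`, `j ∈ T i`, does. -/
def isolatedEvent {ι Ω : Type*} (A : ι → Set Ω) (T : ι → Finset ι) (i : ι) : Set Ω :=
  A i ∩ ⋂ j ∈ T i, (A j)ᶜ

theorem abs_exp_neg_sub_exp_neg_le {a b : ℝ} (ha : 0 ≤ a) (hb : 0 ≤ b) :
    |Real.exp (-a) - Real.exp (-b)| ≤ |a - b| := by
  wlog h : a ≤ b generalizing a b
  · rw [abs_sub_comm, abs_sub_comm a]; exact this hb ha (le_of_not_ge h)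
  rw [abs_of_nonneg (sub_nonneg.2 (Real.exp_le_exp.2 (by linarith))), abs_sub_comm,
    abs_of_nonneg (sub_nonneg.2 h)]
  have h1 : Real.exp (-b) = Real.exp (-a) * Real.exp (-(b - a)) := by
    rw [← Real.exp_add]; ring_nf
  have h2 := Real.add_one_le_exp (-(b - a))
  have h3 : Real.exp (-a) ≤ 1 := Real.exp_le_one_iff.2 (by linarith)
  rw [h1]
  nlinarith [Real.exp_pos (-a)]

theorem isolatedEvent_inter_eq_empty {ι Ω : Type*} {A : ι → Set Ω} {T : ι → Finset ι} {i j : ι}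
    (h : j ∈ T i ∨ i ∈ T j) :
    isolatedEvent A T i ∩ isolatedEvent A T j = ∅ := by
  ext ω
  simp only [isolatedEvent, Set.mem_inter_iff, Set.mem_iInter, Set.mem_compl_iff,
    Set.mem_empty_iff_false, iff_false]
  rintro ⟨⟨h1, h2⟩, h3, h4⟩
  rcases h with h | h
  · exact h2 j h h3
  · exact h4 i h h1

section IndependentEvents

variable {ι Ω : Type*} [MeasurableSpace Ω] {P : Measure Ω} {A : ι → Set Ω} {m : ι → ℝ}
  {T : ι → Finset ι}

theorem measurableSet_isolatedEvent (hA : ∀ i, MeasurableSet (A i)) (i : ι) :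
    MeasurableSet (isolatedEvent A T i) :=
  (hA i).inter (Finset.measurableSet_biInter _ fun j _ => (hA j).compl)

/-- An isolated event depends only on the sites in `insert i (T i)`. -/
theorem indepFun_isolatedEvent [DecidableEq ι] (hA : ∀ i, MeasurableSet (A i))
    (hind : iIndepSet A P) (i : ι) {S : Finset ι}
    (hS : ∀ j ∈ S, Disjoint (insert i (T i)) (insert j (T j))) :
    IndepFun ((isolatedEvent A T i).indicator fun _ => (1 : ℝ))
      (eventCount (isolatedEvent A T) S) P := by
  set σ : ι → MeasurableSpace Ω := fun k => MeasurableSpace.generateFrom {A k} with hσ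
  have hAσ : ∀ k, MeasurableSet[σ k] (A k) := fun k =>
    MeasurableSpace.measurableSet_generateFrom rfl
  have hσle : ∀ k, σ k ≤ ‹MeasurableSpace Ω› := fun k =>
    MeasurableSpace.generateFrom_le fun s hs => by rw [Set.mem_singleton_iff.1 hs]; exact hA k
  set D : Set ι := {k | k ∈ insert i (T i)} with hD
  have key : Indep (⨆ k ∈ D, σ k) (⨆ k ∈ Dᶜ, σ k) P :=
    indep_iSup_of_disjoint hσle hind disjoint_compl_right
  have hmeas : ∀ (F : Set ι) (j : ι), (∀ k ∈ insert j (T j), k ∈ F) →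
      MeasurableSet[⨆ k ∈ F, σ k] (isolatedEvent A T j) := by
    intro F j hF
    have hk : ∀ k ∈ insert j (T j), MeasurableSet[⨆ k ∈ F, σ k] (A k) := fun k hk =>
      (le_iSup₂_of_le (f := fun k (_ : k ∈ F) => σ k) k (hF k hk) le_rfl) _ (hAσ k)
    refine MeasurableSet.inter (hk j (by simp)) ?_
    exact Finset.measurableSet_biInter _ fun k hk' =>
      (hk k (Finset.mem_insert_of_mem hk')).compl
  rw [IndepFun_iff_Indep]
  refine indep_of_indep_of_le_left (indep_of_indep_of_le_right key ?_) ?_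
  · refine Measurable.comap_le ?_
    refine measurable_eventCount (m := ⨆ k ∈ Dᶜ, σ k) fun j hj => hmeas _ j fun k hk hkD => ?_
    exact Finset.disjoint_left.1 (hS j hj) hkD hk
  · refine Measurable.comap_le ?_
    exact Measurable.indicator (m := ⨆ k ∈ D, σ k) measurable_const (hmeas _ i fun k hk => hk)

theorem iIndepSet.measureReal_inter_compl [DecidableEq ι] (hind : iIndepSet A P)
    (hm : ∀ i, P.real (A i)ᶜ = Real.exp (-m i)) {S R : Finset ι} (hSR : Disjoint S R) :
    P.real ((⋂ i ∈ S, A i) ∩ ⋂ j ∈ R, (A j)ᶜ) =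
      (∏ i ∈ S, P.real (A i)) * Real.exp (-∑ j ∈ R, m j) := by
  have h := (iIndepSet_iff A P).1 hind (S ∪ R)
    (f := fun i => if i ∈ S then A i else (A i)ᶜ) (fun i _ => by
      have : MeasurableSet[MeasurableSpace.generateFrom {A i}] (A i) :=
        MeasurableSpace.measurableSet_generateFrom rfl
      split_ifs
      · exact this
      · exact this.compl)
  have hset : (⋂ i ∈ S ∪ R, if i ∈ S then A i else (A i)ᶜ) =
      (⋂ i ∈ S, A i) ∩ ⋂ j ∈ R, (A j)ᶜ := by
    have hunion : ∀ F : ι → Set Ω, ⋂ i ∈ S ∪ R, F i = (⋂ i ∈ S, F i) ∩ ⋂ j ∈ R, F j := by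
      intro F; ext ω
      simp only [Set.mem_inter_iff, Set.mem_iInter, Finset.mem_union, or_imp, forall_and]
    rw [hunion]
    congr 1
    · exact Set.iInter₂_congr fun i hi => if_pos hi
    · exact Set.iInter₂_congr fun i hi => if_neg (Finset.disjoint_right.1 hSR hi)
  rw [hset] at h
  rw [measureReal_def, h, Finset.prod_union hSR, ENNReal.toReal_mul, ENNReal.toReal_prod,
    ENNReal.toReal_prod, ← Finset.sum_neg_distrib, Real.exp_sum]
  congr 1
  · exact Finset.prod_congr rfl fun i hi => by rw [if_pos hi]; rfl
  · exact Finset.prod_congr rfl fun i hi => by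
      rw [if_neg (Finset.disjoint_right.1 hSR hi), ← hm]; rfl

variable [IsProbabilityMeasure P]

theorem measureReal_eq_one_sub_exp (hA : ∀ i, MeasurableSet (A i))
    (hm : ∀ i, P.real (A i)ᶜ = Real.exp (-m i)) (i : ι) :
    P.real (A i) = 1 - Real.exp (-m i) := by
  rw [← hm, probReal_compl_eq_one_sub (hA i)]; ring

variable [DecidableEq ι]

theorem measureReal_isolatedEvent (hA : ∀ i, MeasurableSet (A i)) (hind : iIndepSet A P)
    (hm : ∀ i, P.real (A i)ᶜ = Real.exp (-m i)) (hT : ∀ i, i ∉ T i) (i : ι) :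
    P.real (isolatedEvent A T i) = (1 - Real.exp (-m i)) * Real.exp (-∑ j ∈ T i, m j) := by
  have := iIndepSet.measureReal_inter_compl hind hm (Finset.disjoint_singleton_left.2 (hT i))
  simpa [isolatedEvent, measureReal_eq_one_sub_exp hA hm] using this

theorem measureReal_isolatedEvent_inter_le (hA : ∀ i, MeasurableSet (A i))
    (hind : iIndepSet A P) (hm : ∀ i, P.real (A i)ᶜ = Real.exp (-m i)) (hm0 : ∀ i, 0 ≤ m i)
    (hT : ∀ i, i ∉ T i) {i j : ι} (hij : i ≠ j) (hi : i ∉ T j) (hj : j ∉ T i) :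
    P.real (isolatedEvent A T i ∩ isolatedEvent A T j) ≤
      m i * m j * Real.exp (-∑ k ∈ T i ∪ T j, m k) := by
  have hd : Disjoint {i, j} (T i ∪ T j) := by
    simp [hT, hi, hj]
  have := iIndepSet.measureReal_inter_compl hind hm hd
  have hset : isolatedEvent A T i ∩ isolatedEvent A T j =
      (⋂ k ∈ ({i, j} : Finset ι), A k) ∩ ⋂ k ∈ T i ∪ T j, (A k)ᶜ := by
    ext ω
    simp only [isolatedEvent, Set.mem_inter_iff, Set.mem_iInter, Finset.mem_union,
      Finset.mem_insert, Finset.mem_singleton, or_imp, forall_and, forall_eq]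
    tauto
  have hle : ∀ k, P.real (A k) ≤ m k := fun k => by
    rw [measureReal_eq_one_sub_exp hA hm]
    linarith [Real.add_one_le_exp (-m k)]
  rw [hset, this, Finset.prod_pair hij]
  gcongr
  exacts [hm0 i, hle i, hle j]

/-- Poisson approximation for isolated occupied sites. The site `j` carries mass `m j` and is
vacant with probability `exp (-m j)`, independently of the others; `l` is close to the mass of each
`T i`, and the mass of the union of two of these neighbourhoods exceeds `l` by a fixed proportion
if neither of the two sites lies in the neighbourhood of the other. -/
theorem abs_measureReal_no_isolatedEvent_sub_exp_le (hA : ∀ i, MeasurableSet (A i))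
    (hind : iIndepSet A P) (hm : ∀ i, P.real (A i)ᶜ = Real.exp (-m i)) (hm0 : ∀ i, 0 ≤ m i)
    (hT : ∀ i, i ∉ T i) (V : Finset ι) {l γ Q c t : ℝ} (hγ : γ ≤ 1)
    (ht : ∑ i ∈ V, m i = t) (hmγ : ∀ i ∈ V, m i ≤ γ)
    (hTl : ∀ i ∈ V, |∑ j ∈ T i, m j - l| ≤ 2 * γ)
    (hQ : ∀ i ∈ V, ∑ j ∈ V with ¬ Disjoint (insert i (T i)) (insert j (T j)), m j ≤ Q)
    (hc : ∀ i ∈ V, ∀ j ∈ V, i ≠ j → i ∉ T j → j ∉ T i →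
      (1 + c) * l - 2 * γ ≤ ∑ k ∈ T i ∪ T j, m k) :
    |P.real {ω | ∀ i ∈ V, ω ∉ isolatedEvent A T i} - Real.exp (-(t * Real.exp (-l)))| ≤
      t * Real.exp (-l) * (Real.exp (2 * γ) - (1 - γ) * Real.exp (-(2 * γ))) +
        t * Q * Real.exp (-l + 2 * γ) ^ 2 + t * Q * Real.exp (-((1 + c) * l) + 2 * γ) := by
  set p : ι → ℝ := fun i => P.real (isolatedEvent A T i) with hp
  set B : ι → Finset ι := fun i =>
    {j ∈ V | ¬ Disjoint (insert i (T i)) (insert j (T j))} with hB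
  have hpi : ∀ i, p i = (1 - Real.exp (-m i)) * Real.exp (-∑ j ∈ T i, m j) := fun i =>
    measureReal_isolatedEvent hA hind hm hT i
  have hp0 : ∀ i, 0 ≤ p i := fun i => measureReal_nonneg
  have ht0 : 0 ≤ t := ht ▸ Finset.sum_nonneg fun i _ => hm0 i
  have hple : ∀ i ∈ V, p i ≤ m i * Real.exp (-l + 2 * γ) := by
    intro i hi
    rw [hpi]
    have h1 := (abs_le.1 (hTl i hi)).1
    have h2 := Real.add_one_le_exp (-m i)
    have h3 := hm0 i
    gcongr <;> linarith
  have hpge : ∀ i ∈ V, m i * (1 - γ) * Real.exp (-l - 2 * γ) ≤ p i := by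
    intro i hi
    rw [hpi]
    have h1 := (abs_le.1 (hTl i hi)).2
    have h3 := hm0 i
    have h4 := hmγ i hi
    have h2 : m i * (1 - γ) ≤ 1 - Real.exp (-m i) := by
      have h5 : Real.exp (-m i) ≤ 1 - m i + m i ^ 2 := by
        have := Real.abs_exp_sub_one_sub_id_le (x := -m i)
          (by rw [abs_neg, abs_of_nonneg h3]; linarith)
        have := (abs_le.1 this).2
        nlinarith
      nlinarith
    have h6 : 0 ≤ m i * (1 - γ) := mul_nonneg h3 (by linarith)
    exact mul_le_mul h2 (Real.exp_le_exp.2 (by linarith)) (Real.exp_pos _).le (h6.trans h2)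
  have hQ0 : ∀ i ∈ V, 0 ≤ Q := fun i hi =>
    (Finset.sum_nonneg fun j _ => hm0 j).trans (hQ i hi)
  have hcs := chenStein_none P V (isolatedEvent A T) (measurableSet_isolatedEvent hA) B
    (fun i _ => Finset.filter_subset _ _) (fun i hi => by simp [hB, hi])
    (fun i hi => indepFun_isolatedEvent hA hind i fun j hj => by
      simp only [hB, Finset.mem_sdiff, Finset.mem_filter, not_and, not_not] at hj
      exact hj.2 hj.1)
  have hlam : |∑ i ∈ V, p i - t * Real.exp (-l)| ≤
      t * Real.exp (-l) * (Real.exp (2 * γ) - (1 - γ) * Real.exp (-(2 * γ))) := by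
    have hu : ∑ i ∈ V, p i ≤ t * (Real.exp (-l) * Real.exp (2 * γ)) := by
      rw [← Real.exp_add, ← ht, Finset.sum_mul]
      exact Finset.sum_le_sum hple
    have hd : t * ((1 - γ) * (Real.exp (-l) * Real.exp (-(2 * γ)))) ≤ ∑ i ∈ V, p i := by
      rw [← Real.exp_add, ← ht, Finset.sum_mul]
      refine Finset.sum_le_sum fun i hi => le_trans (le_of_eq ?_) (hpge i hi)
      rw [← sub_eq_add_neg, mul_assoc]
    have hγ0 : V.Nonempty → 0 ≤ γ := fun ⟨i, hi⟩ => (hm0 i).trans (hmγ i hi)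
    rcases V.eq_empty_or_nonempty with rfl | hV
    · simp at ht
      simp [← ht]
    · have hγ0 := hγ0 hV
      have e1 : 1 ≤ Real.exp (2 * γ) := Real.one_le_exp (by linarith)
      have e2 : (1 - γ) * Real.exp (-(2 * γ)) ≤ 1 :=
        mul_le_one₀ (by linarith) (Real.exp_pos _).le (Real.exp_le_one_iff.2 (by linarith))
      have e3 : 0 ≤ t * Real.exp (-l) := mul_nonneg ht0 (Real.exp_pos _).le
      rw [abs_le]
      constructor <;> nlinarith
  have hb1 : ∑ i ∈ V, ∑ j ∈ B i, p i * p j ≤ t * Q * Real.exp (-l + 2 * γ) ^ 2 := by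
    have : ∀ i ∈ V, ∑ j ∈ B i, p i * p j ≤ m i * (Q * Real.exp (-l + 2 * γ) ^ 2) := by
      intro i hi
      rw [← Finset.mul_sum]
      have h1 : ∑ j ∈ B i, p j ≤ Q * Real.exp (-l + 2 * γ) := by
        refine (Finset.sum_le_sum fun j hj => hple j (Finset.mem_of_mem_filter j hj)).trans ?_
        rw [← Finset.sum_mul]
        exact mul_le_mul_of_nonneg_right (hQ i hi) (Real.exp_pos _).le
      calc p i * ∑ j ∈ B i, p j ≤ (m i * Real.exp (-l + 2 * γ)) * (Q * Real.exp (-l + 2 * γ)) :=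
            mul_le_mul (hple i hi) h1 (Finset.sum_nonneg fun j _ => hp0 j)
              (mul_nonneg (hm0 i) (Real.exp_pos _).le)
        _ = _ := by ring
    refine (Finset.sum_le_sum this).trans (le_of_eq ?_)
    rw [← Finset.sum_mul, ht]; ring
  have hb2 : ∑ i ∈ V, ∑ j ∈ (B i).erase i, P.real (isolatedEvent A T i ∩ isolatedEvent A T j) ≤
      t * Q * Real.exp (-((1 + c) * l) + 2 * γ) := by
    have : ∀ i ∈ V, ∑ j ∈ (B i).erase i, P.real (isolatedEvent A T i ∩ isolatedEvent A T j) ≤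
        m i * (Q * Real.exp (-((1 + c) * l) + 2 * γ)) := by
      intro i hi
      have h1 : ∀ j ∈ (B i).erase i, P.real (isolatedEvent A T i ∩ isolatedEvent A T j) ≤
          m i * m j * Real.exp (-((1 + c) * l) + 2 * γ) := by
        intro j hj
        have hjV : j ∈ V := Finset.mem_of_mem_filter j (Finset.mem_of_mem_erase hj)
        have hij : i ≠ j := (Finset.ne_of_mem_erase hj).symm
        have h0 : 0 ≤ m i * m j := mul_nonneg (hm0 i) (hm0 j)
        by_cases h : j ∈ T i ∨ i ∈ T j
        · rw [isolatedEvent_inter_eq_empty h, measureReal_empty]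
          exact mul_nonneg h0 (Real.exp_pos _).le
        · push Not at h
          refine (measureReal_isolatedEvent_inter_le hA hind hm hm0 hT hij h.2 h.1).trans ?_
          have := hc i hi j hjV hij h.2 h.1
          gcongr
          linarith
      refine (Finset.sum_le_sum h1).trans ?_
      rw [← Finset.sum_mul, ← Finset.mul_sum, mul_assoc]
      refine mul_le_mul_of_nonneg_left ?_ (hm0 i)
      refine mul_le_mul_of_nonneg_right ?_ (Real.exp_pos _).le
      exact (Finset.sum_le_sum_of_subset_of_nonneg (Finset.erase_subset _ _)
        fun j _ _ => hm0 j).trans (hQ i hi)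
    refine (Finset.sum_le_sum this).trans (le_of_eq ?_)
    rw [← Finset.sum_mul, ht]; ring
  have hexp := abs_exp_neg_sub_exp_neg_le (Finset.sum_nonneg fun i (_ : i ∈ V) => hp0 i)
    (mul_nonneg ht0 (Real.exp_pos (-l)).le)
  have := abs_sub_le (P.real {ω | ∀ i ∈ V, ω ∉ isolatedEvent A T i})
    (Real.exp (-∑ i ∈ V, p i)) (Real.exp (-(t * Real.exp (-l))))
  linarith

end IndependentEvents

/-! ### Balls of prescribed mass and partitions into small cells -/

theorem Metric.ball_subset_thickening_of_le {E : Type*} [NormedAddCommGroup E] {W : Set E} {x : E}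
    (hx : x ∈ W) {r δ : ℝ}
    (h : r ≤ δ) : Metric.ball x r ⊆ Metric.thickening δ W :=
  (Metric.ball_subset_ball h).trans (Metric.ball_subset_thickening hx δ)

section Regularity

variable {E : Type*} [NormedAddCommGroup E] [MeasurableSpace E]

/-- The measure `μ` behaves like a `d`-dimensional volume at scales up to `δ` around `W`: balls of
radius `r` have measure between `a * r ^ d` and `b * r ^ d`, and annuli of width `w` have measure
at most `L * w`. -/
structure RegularNear (μ : Measure E) (W : Set E) (d : ℕ) (δ a b L : ℝ) : Prop where
  finite : ∀ x r, μ (Metric.ball x r) ≠ ∞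
  δ_pos : 0 < δ
  a_pos : 0 < a
  b_pos : 0 < b
  L_pos : 0 < L
  lower : ∀ z r, 0 ≤ r → Metric.ball z r ⊆ Metric.thickening δ W →
    a * r ^ d ≤ μ.real (Metric.ball z r)
  upper : ∀ z r, 0 ≤ r → Metric.ball z r ⊆ Metric.thickening δ W →
    μ.real (Metric.ball z r) ≤ b * r ^ d
  annulus : ∀ x ∈ W, ∀ s r, 0 ≤ s → s ≤ r → r ≤ δ →
    μ.real (Metric.ball x r) ≤ μ.real (Metric.ball x s) + L * (r - s)

/-- The smallest radius of a ball around `x` whose `μ`-measure is at least `v`. -/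
noncomputable def massRadius (μ : Measure E) (v : ℝ) (x : E) : ℝ :=
  sInf {r | 0 ≤ r ∧ v ≤ μ.real (Metric.ball x r)}

theorem massRadius_nonneg (μ : Measure E) (v : ℝ) (x : E) : 0 ≤ massRadius μ v x :=
  Real.sInf_nonneg fun _ h => h.1

theorem massRadius_le {μ : Measure E} {v r : ℝ} {x : E} (hr : 0 ≤ r)
    (h : v ≤ μ.real (Metric.ball x r)) : massRadius μ v x ≤ r :=
  csInf_le ⟨0, fun _ h => h.1⟩ ⟨hr, h⟩

namespace RegularNear

variable {μ : Measure E} {W : Set E} {d : ℕ} {δ a b L : ℝ} (h : RegularNear μ W d δ a b L)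
include h

theorem measureReal_ball_mono {x y : E} {r s : ℝ} (hrs : Metric.ball x r ⊆ Metric.ball y s) :
    μ.real (Metric.ball x r) ≤ μ.real (Metric.ball y s) :=
  measureReal_mono hrs (h.finite y s)

theorem massRadius_le_δ {v : ℝ} (hv : v ≤ a * δ ^ d) {x : E} (hx : x ∈ W) :
    massRadius μ v x ≤ δ :=
  massRadius_le h.δ_pos.le
    (hv.trans (h.lower x δ h.δ_pos.le (Metric.ball_subset_thickening_of_le hx le_rfl)))

/-- As small annuli have small measure, the smallest ball of measure at least `v` has measure
exactly `v`. -/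
theorem measureReal_ball_massRadius {v : ℝ} (hv0 : 0 < v) (hv : v ≤ a * δ ^ d) {x : E}
    (hx : x ∈ W) : μ.real (Metric.ball x (massRadius μ v x)) = v := by
  set S := {r | 0 ≤ r ∧ v ≤ μ.real (Metric.ball x r)} with hS
  have hδ : δ ∈ S := ⟨h.δ_pos.le,
    hv.trans (h.lower x δ h.δ_pos.le (Metric.ball_subset_thickening_of_le hx le_rfl))⟩
  have hρδ := h.massRadius_le_δ hv hx
  have hρ0 := massRadius_nonneg μ v x
  set ρ := massRadius μ v x with hρ
  have hL := h.L_pos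
  apply le_antisymm
  · by_contra! hlt
    set η := (μ.real (Metric.ball x ρ) - v) / (2 * L) with hη
    have hη0 : 0 < η := by have := sub_pos.2 hlt; positivity
    have hLη : L * η = (μ.real (Metric.ball x ρ) - v) / 2 := by rw [hη]; field_simp
    rcases le_or_gt ρ η with hc | hc
    · have := h.annulus x hx 0 ρ le_rfl hρ0 hρδ
      simp only [Metric.ball_zero, measureReal_empty] at this
      nlinarith
    · have h1 := h.annulus x hx (ρ - η) ρ (by linarith) (by linarith) hρδ
      have h2 : ρ ≤ ρ - η := massRadius_le (by linarith) (by nlinarith)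
      linarith
  · by_contra! hlt
    set η := (v - μ.real (Metric.ball x ρ)) / (2 * L) with hη
    have hη0 : 0 < η := by have := sub_pos.2 hlt; positivity
    have hLη : L * η = (v - μ.real (Metric.ball x ρ)) / 2 := by rw [hη]; field_simp
    obtain ⟨s, hs, hsρ⟩ := exists_lt_of_csInf_lt ⟨δ, hδ⟩ (show sInf S < ρ + η by
      change ρ < _; linarith)
    have hρs : ρ ≤ min s δ := le_min (csInf_le ⟨0, fun _ h => h.1⟩ hs) hρδ
    have h1 := h.annulus x hx ρ (min s δ) hρ0 hρs (min_le_right _ _)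
    have h2 : v ≤ μ.real (Metric.ball x (min s δ)) := by
      rcases min_choice s δ with h' | h' <;> rw [h']
      exacts [hs.2, hδ.2]
    have h3 : min s δ ≤ s := min_le_left _ _
    nlinarith

/-- The critical radius is a `1`-Lipschitz function of the centre. -/
theorem massRadius_le_add_dist {v : ℝ} (hv0 : 0 < v) (hv : v ≤ a * δ ^ d) (x : E) {y : E}
    (hy : y ∈ W) : massRadius μ v x ≤ massRadius μ v y + dist x y := by
  refine massRadius_le (add_nonneg (massRadius_nonneg _ _ _) dist_nonneg) ?_
  conv_lhs => rw [← h.measureReal_ball_massRadius hv0 hv hy]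
  exact h.measureReal_ball_mono (Metric.ball_subset_ball' (by rw [dist_comm]))

theorem mul_massRadius_pow_le {v : ℝ} (hv0 : 0 < v) (hv : v ≤ a * δ ^ d) {x : E} (hx : x ∈ W) :
    a * massRadius μ v x ^ d ≤ v := by
  have := h.lower x _ (massRadius_nonneg μ v x)
    (Metric.ball_subset_thickening_of_le hx (h.massRadius_le_δ hv hx))
  rwa [h.measureReal_ball_massRadius hv0 hv hx] at this

theorem le_mul_massRadius_pow {v : ℝ} (hv0 : 0 < v) (hv : v ≤ a * δ ^ d) {x : E} (hx : x ∈ W) :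
    v ≤ b * massRadius μ v x ^ d := by
  have := h.upper x _ (massRadius_nonneg μ v x)
    (Metric.ball_subset_thickening_of_le hx (h.massRadius_le_δ hv hx))
  rwa [h.measureReal_ball_massRadius hv0 hv hx] at this

end RegularNear

end Regularity

section Cells

variable {E : Type*} [NormedAddCommGroup E] [MeasurableSpace E]

/-- The sets `C i` form a finite measurable partition of `K` into nonempty cells of diameter at
most `ε`, each of which is either contained in `W` or disjoint from `W`. -/
structure IsCellPartition {ι : Type*} (C : ι → Set E) (K W : Set E) (ε : ℝ) : Prop where
  measurableSet : ∀ i, MeasurableSet (C i)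
  disjoint : Pairwise fun i j => Disjoint (C i) (C j)
  iUnion : ⋃ i, C i = K
  nonempty : ∀ i, (C i).Nonempty
  dist_le : ∀ i, ∀ x ∈ C i, ∀ y ∈ C i, dist x y ≤ ε
  subset_or_disjoint : ∀ i, C i ⊆ W ∨ Disjoint (C i) W

theorem exists_isCellPartition [NormedSpace ℝ E] [FiniteDimensional ℝ E] [BorelSpace E]
    {K W : Set E} (hK : MeasurableSet K) (hKb : Bornology.IsBounded K) (hW : MeasurableSet W)
    {ε : ℝ} (hε : 0 < ε) :
    ∃ (ι : Type) (_ : Fintype ι) (C : ι → Set E), IsCellPartition C K W ε := by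
  have : ProperSpace E := FiniteDimensional.proper_real E
  obtain ⟨s, hs, hcov⟩ := Metric.totallyBounded_iff.1
    (hKb.isCompact_closure.totallyBounded.subset subset_closure) (ε / 2) (by positivity)
  obtain ⟨n, e, he⟩ := hs.fin_embedding
  set D : ℕ → Set E := fun k => if hk : k < n then Metric.ball (e ⟨k, hk⟩) (ε / 2) else ∅ with hD
  have hDm : ∀ k, MeasurableSet (D k) := by
    intro k
    simp only [hD]
    split_ifs
    exacts [Metric.isOpen_ball.measurableSet, .empty]
  set C' : Fin n × Bool → Set E := fun p =>
    disjointed D p.1 ∩ K ∩ (if p.2 then W else Wᶜ) with hC'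
  refine ⟨{p // (C' p).Nonempty}, Fintype.ofFinite _, fun p => C' p.1, ?_, ?_, ?_, ?_, ?_, ?_⟩
  · intro p
    simp only [hC']
    refine ((MeasurableSet.disjointed hDm _).inter hK).inter ?_
    split_ifs
    exacts [hW, hW.compl]
  · rintro ⟨⟨k, b⟩, h⟩ ⟨⟨k', b'⟩, h'⟩ hne
    rw [Set.disjoint_left]
    rintro y ⟨⟨hy1, -⟩, hy2⟩ ⟨⟨hy1', -⟩, hy2'⟩
    apply hne
    have hk : (k : ℕ) = k' := by
      by_contra hkk
      exact Set.disjoint_left.1 (disjoint_disjointed D hkk) hy1 hy1'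
    have hb : b = b' := by
      cases b <;> cases b' <;> simp_all
    cases Fin.ext hk
    cases hb
    rfl
  · ext y
    simp only [Set.mem_iUnion, Subtype.exists, exists_prop]
    constructor
    · rintro ⟨p, -, hp⟩
      exact hp.1.2
    · intro hy
      have hyD : y ∈ ⋃ k, disjointed D k := by
        rw [iUnion_disjointed]
        obtain ⟨z, hz, hyz⟩ := Set.mem_iUnion₂.1 (hcov hy)
        rw [← he] at hz
        obtain ⟨k, rfl⟩ := hz
        exact Set.mem_iUnion.2 ⟨k, by simpa [hD] using hyz⟩
      obtain ⟨k, hk⟩ := Set.mem_iUnion.1 hyD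
      have hkn : k < n := by
        by_contra hkn
        have := disjointed_le D k hk
        simp [hD, hkn] at this
      by_cases hyW : y ∈ W
      · have : y ∈ C' (⟨k, hkn⟩, true) := ⟨⟨hk, hy⟩, by simpa using hyW⟩
        exact ⟨_, ⟨y, this⟩, this⟩
      · have : y ∈ C' (⟨k, hkn⟩, false) := ⟨⟨hk, hy⟩, by simpa using hyW⟩
        exact ⟨_, ⟨y, this⟩, this⟩
  · exact fun p => p.2
  · rintro ⟨⟨k, b⟩, h⟩ x hx y hy
    have h1 := disjointed_le D k hx.1.1
    have h2 := disjointed_le D k hy.1.1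
    simp only [hD, k.2, dif_pos, Metric.mem_ball] at h1 h2
    linarith [dist_triangle_right x y (e k)]
  · rintro ⟨⟨k, b⟩, -⟩
    cases b
    · right
      exact Set.disjoint_left.2 fun y hy => by simpa using hy.2
    · left
      exact fun y hy => by simpa using hy.2

namespace IsCellPartition

variable {ι : Type*} {C : ι → Set E} {K W : Set E} {ε : ℝ}
  (hC : IsCellPartition C K W ε) (μ : Measure E)
include hC

theorem eq_of_mem {i j : ι} {y : E} (hi : y ∈ C i) (hj : y ∈ C j) : i = j := by
  by_contra hij
  exact Set.disjoint_left.1 (hC.disjoint hij) hi hj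

theorem exists_mem {y : E} (hy : y ∈ K) : ∃ i, y ∈ C i := by
  rw [← hC.iUnion] at hy
  exact Set.mem_iUnion.1 hy

theorem subset_of_mem {i : ι} {y : E} (hi : y ∈ C i) (hy : y ∈ W) : C i ⊆ W :=
  (hC.subset_or_disjoint i).resolve_right fun h => Set.disjoint_left.1 h hi hy

theorem measure_ne_top (hK : μ K ≠ ∞) (i : ι) : μ (C i) ≠ ∞ :=
  measure_ne_top_of_subset (by rw [← hC.iUnion]; exact Set.subset_iUnion C i) hK

theorem sum_measureReal (hK : μ K ≠ ∞) (S : Finset ι) :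
    ∑ i ∈ S, μ.real (C i) = μ.real (⋃ i ∈ S, C i) :=
  (measureReal_biUnion_finset (fun _ _ _ _ hij => hC.disjoint hij)
    (fun i _ => hC.measurableSet i) fun i _ => hC.measure_ne_top μ hK i).symm

theorem sum_measureReal_le (hK : μ K ≠ ∞) {S : Finset ι} {F : Set E} (hF : μ F ≠ ∞)
    (h : ∀ i ∈ S, C i ⊆ F) : ∑ i ∈ S, μ.real (C i) ≤ μ.real F := by
  rw [hC.sum_measureReal μ hK]
  exact measureReal_mono (Set.iUnion₂_subset h) hF

theorem le_sum_measureReal (hK : μ K ≠ ∞) {S : Finset ι} {F : Set E}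
    (h : ∀ y ∈ F, ∃ i ∈ S, y ∈ C i) : μ.real F ≤ ∑ i ∈ S, μ.real (C i) := by
  rw [hC.sum_measureReal μ hK]
  refine measureReal_mono (fun y hy => ?_) ?_
  · obtain ⟨i, hi, hy⟩ := h y hy
    exact Set.mem_iUnion₂.2 ⟨i, hi, hy⟩
  · refine measure_ne_top_of_subset ?_ hK
    rw [← hC.iUnion]
    exact Set.iUnion₂_subset fun i _ => Set.subset_iUnion C i

end IsCellPartition

end Cells

/-! ### Counting measures and Poisson processes -/

section CountingMeasures

variable {E : Type*} [MetricSpace E] [SecondCountableTopology E] [MeasurableSpace E]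
  [BorelSpace E] {ν : Measure E}

/-- A locally finite counting measure that charges a set has an atom in it. -/
theorem IsLocFinCounting.exists_mem_points (hν : IsLocFinCounting ν) {B : Set E} (hB : ν B ≠ 0) :
    ∃ x ∈ B, x ∈ points ν := by
  have := hν.locallyFinite
  by_contra! hcon
  apply hB
  refine measure_null_of_locally_null B fun x hx => ?_
  have hx0 : ν {x} = 0 := by simpa [points] using hcon x hx
  obtain ⟨U, hxU, hU, hU1⟩ := Set.exists_isOpen_lt_of_lt {x} 1 (by rw [hx0]; exact one_pos)
  refine ⟨U, mem_nhdsWithin_of_mem_nhds (hU.mem_nhds (by simpa using hxU)), ?_⟩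
  obtain ⟨n, hn⟩ := hν.counting U hU.measurableSet
  rw [hn] at hU1 ⊢
  have hn0 : n = 0 := by
    have : n < 1 := by exact_mod_cast hU1
    simpa using this
  simp [hn0]

/-- A counting measure that gives mass at most `1` to a set has at most one atom in it. -/
theorem IsLocFinCounting.eq_of_mem_points (hν : IsLocFinCounting ν) {B : Set E} (hB : ν B ≤ 1)
    {x y : E} (hxB : x ∈ B) (hyB : y ∈ B) (hx : x ∈ points ν) (hy : y ∈ points ν) : x = y := by
  by_contra hxy
  have hone : ∀ z ∈ points ν, 1 ≤ ν {z} := by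
    intro z hz
    obtain ⟨n, hn⟩ := hν.counting {z} (measurableSet_singleton z)
    have hz' : ν {z} ≠ 0 := hz
    rw [hn] at hz' ⊢
    have : 1 ≤ n := Order.one_le_iff_ne_zero.2 (by rintro rfl; simp at hz')
    exact_mod_cast this
  have h2 : ν {x} + ν {y} ≤ ν B := by
    rw [← measure_union (by simpa using hxy) (measurableSet_singleton y)]
    exact measure_mono (Set.union_subset (by simpa using hxB) (by simpa using hyB))
  have h3 : (1 : ℝ≥0∞) + 1 ≤ 1 := (add_le_add (hone x hx) (hone y hy)).trans (h2.trans hB)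
  norm_num at h3

end CountingMeasures

namespace IsPoissonProcess

variable {Ω E : Type*} [MeasurableSpace Ω] [TopologicalSpace E] [MeasurableSpace E]
  {P : Measure Ω} {Λ : Measure E} {η : Ω → Measure E} (h : IsPoissonProcess P Λ η)
include h

theorem measurable_apply {B : Set E} (hB : MeasurableSet B) : Measurable fun ω => η ω B :=
  (Measure.measurable_coe hB).comp h.measurable

theorem measureReal_preimage {B : Set E} (hB : MeasurableSet B) (hΛ : Λ B ≠ ∞) {S : Set ℝ≥0∞}
    (hS : MeasurableSet S) :
    P.real {ω | η ω B ∈ S} = (poissonMeasure (Λ B).toNNReal).real {k : ℕ | (k : ℝ≥0∞) ∈ S} := by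
  have h1 := congrArg (fun κ : Measure ℝ≥0∞ => κ.real S) (h.poisson B hB hΛ)
  rw [map_measureReal_apply (h.measurable_apply hB) hS,
    map_measureReal_apply measurable_from_nat hS] at h1
  exact h1

theorem measureReal_eq_zero {B : Set E} (hB : MeasurableSet B) (hΛ : Λ B ≠ ∞) :
    P.real {ω | η ω B ≠ 0}ᶜ = Real.exp (-Λ.real B) := by
  have h1 := h.measureReal_preimage hB hΛ (measurableSet_singleton 0)
  have h2 : {k : ℕ | (k : ℝ≥0∞) ∈ ({0} : Set ℝ≥0∞)} = {0} := by ext; simp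
  rw [h2, poissonMeasure_real_singleton] at h1
  have h3 : {ω | η ω B ≠ 0}ᶜ = {ω | η ω B ∈ ({0} : Set ℝ≥0∞)} := by ext; simp
  have h4 : ((Λ B).toNNReal : ℝ) = Λ.real B := rfl
  rw [h3, h1, h4]
  simp

theorem measureReal_one_lt_le {B : Set E} (hB : MeasurableSet B) (hΛ : Λ B ≠ ∞) :
    P.real {ω | 1 < η ω B} ≤ Λ.real B ^ 2 := by
  have h1 := h.measureReal_preimage hB hΛ (measurableSet_Ioi (a := 1))
  have h2 : {k : ℕ | (k : ℝ≥0∞) ∈ Set.Ioi 1} = ({0, 1} : Set ℕ)ᶜ := by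
    ext k
    simp only [Set.mem_Ioi, Set.mem_ofPred_eq, Set.mem_compl_iff, Set.mem_insert_iff,
      Set.mem_singleton_iff, Nat.one_lt_cast]
    omega
  rw [h2, probReal_compl_eq_one_sub (by measurability), Set.insert_eq,
    measureReal_union (by simp) (by measurability), poissonMeasure_real_singleton,
    poissonMeasure_real_singleton] at h1
  have h3 : ((Λ B).toNNReal : ℝ) = Λ.real B := rfl
  change P.real {ω | 1 < η ω B} = _ at h1
  rw [h1, h3]
  have h4 := Real.add_one_le_exp (-Λ.real B)
  have h5 : 0 ≤ Λ.real B := measureReal_nonneg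
  simp
  nlinarith

theorem iIndepSet_ne_zero {ι : Type*} [Fintype ι] {C : ι → Set E}
    (hC : ∀ i, MeasurableSet (C i)) (hd : Pairwise fun i j => Disjoint (C i) (C j)) :
    iIndepSet (fun i => {ω | η ω (C i) ≠ 0}) P := by
  have e := Fintype.equivFin ι
  have h1 := h.indep _ (fun k => C (e.symm k)) (fun k => hC _)
    fun i j hij => hd (e.symm.injective.ne hij)
  have h2 := h1.precomp e.injective
  refine (iIndepSet_iff _ _).2 fun S f hf => ?_
  refine (iIndep_iff _ _).1 h2.iIndep S fun i hi => ?_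
  refine (MeasurableSpace.generateFrom_le (m := MeasurableSpace.comap _ _) ?_) _ (hf i hi)
  rintro _ rfl
  exact ⟨{0}ᶜ, (measurableSet_singleton _).compl, by ext; simp⟩

end IsPoissonProcess

/-! ### Poisson approximation for nuclei without close neighbours -/

/-- The indices `j ≠ i` of the cells whose marked point `x j` has distance at most `ρ i` from
`x i`. -/
noncomputable def nearCells {ι E : Type*} [Fintype ι] [DecidableEq ι] [PseudoMetricSpace E]
    (x : ι → E) (ρ : ι → ℝ) (i : ι) : Finset ι :=
  {j | j ≠ i ∧ dist (x i) (x j) ≤ ρ i}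

theorem mem_nearCells {ι E : Type*} [Fintype ι] [DecidableEq ι] [PseudoMetricSpace E]
    {x : ι → E} {ρ : ι → ℝ} {i j : ι} :
    j ∈ nearCells x ρ i ↔ j ≠ i ∧ dist (x i) (x j) ≤ ρ i := by
  simp [nearCells]

section CellEstimates

variable {E : Type*} [NormedAddCommGroup E] [MeasurableSpace E]
  {μ : Measure E} {W : Set E} {d : ℕ} {δ a b L : ℝ} (h : RegularNear μ W d δ a b L)
  {v : ℝ} (hv0 : 0 < v) (hv : v ≤ a * δ ^ d)
  {ι : Type*} {C : ι → Set E} {ε : ℝ}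
  (hC : IsCellPartition C (Metric.thickening δ W) W ε) (hK : μ (Metric.thickening δ W) ≠ ∞)
  {x : ι → E} (hx : ∀ i, x i ∈ C i)
  {t γ R : ℝ} (ht : 0 < t) (hε : 0 < ε) (hγ : t * L * (6 * ε) ≤ γ)
  (hr : ∀ y ∈ W, 40 * ε ≤ massRadius μ v y) (hR : ∀ y ∈ W, massRadius μ v y ≤ R)
  (hRδ : 3 * R ≤ δ) {ρ : ι → ℝ}
  (hρ : ∀ i, C i ⊆ W → |ρ i - massRadius μ v (x i)| ≤ 4 * ε)

include h hC hx ht hε hγ hr hR hRδ in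
theorem mul_measureReal_cell_le {i : ι} (hi : C i ⊆ W) : t * μ.real (C i) ≤ γ := by
  have hxi := hi (hx i)
  have h1 := hr _ hxi
  have h2 := hR _ hxi
  have h3 := h.annulus (x i) hxi 0 (6 * ε) le_rfl (by linarith) (by linarith)
  simp only [Metric.ball_zero, measureReal_empty] at h3
  have h4 : μ.real (C i) ≤ μ.real (Metric.ball (x i) (6 * ε)) := by
    refine measureReal_mono (fun y hy => ?_) (h.finite _ _)
    have := hC.dist_le i y hy (x i) (hx i)
    rw [Metric.mem_ball]
    linarith
  nlinarith

variable [Fintype ι] [DecidableEq ι]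

include h hv0 hv hC hK hx ht hε hγ hr hR hRδ hρ in
/-- The cells near `x i`, together with the cell of `x i`, cover the ball of radius
`massRadius μ v (x i) - 6 * ε` and lie in that of radius `massRadius μ v (x i) + 6 * ε`. -/
theorem abs_sum_nearCells_sub_le {i : ι} (hi : C i ⊆ W) :
    |∑ j ∈ nearCells x ρ i, t * μ.real (C j) - t * v| ≤ 2 * γ := by
  have hxi := hi (hx i)
  have h1 := hr _ hxi
  have h2 := hR _ hxi
  have h3 := abs_le.1 (hρ i hi)
  have hvi := h.measureReal_ball_massRadius hv0 hv hxi
  have hcell := mul_measureReal_cell_le h hC hx ht hε hγ hr hR hRδ hi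
  have hγ0 : 0 ≤ γ := le_trans (by have := h.L_pos; positivity) hγ
  set r := massRadius μ v (x i) with hrdef
  rw [← Finset.mul_sum, abs_le]
  constructor
  · have hsum : μ.real (Metric.ball (x i) (r - 6 * ε)) ≤
        ∑ j ∈ insert i (nearCells x ρ i), μ.real (C j) := by
      refine hC.le_sum_measureReal μ hK fun y hy => ?_
      rw [Metric.mem_ball, dist_comm] at hy
      have hyK : y ∈ Metric.thickening δ W :=
        Metric.mem_thickening_iff.2 ⟨x i, hxi, by rw [dist_comm]; linarith⟩
      obtain ⟨j, hj⟩ := hC.exists_mem hyK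
      refine ⟨j, ?_, hj⟩
      by_cases hji : j = i
      · simp [hji]
      · refine Finset.mem_insert_of_mem (mem_nearCells.2 ⟨hji, ?_⟩)
        have := hC.dist_le j y hj (x j) (hx j)
        linarith [dist_triangle (x i) y (x j)]
    rw [Finset.sum_insert (by simp [mem_nearCells])] at hsum
    have hann := h.annulus (x i) hxi (r - 6 * ε) r (by linarith) (by linarith) (by linarith)
    rw [hvi] at hann
    nlinarith
  · have hsum : ∑ j ∈ nearCells x ρ i, μ.real (C j) ≤
        μ.real (Metric.ball (x i) (r + 6 * ε)) := by
      refine hC.sum_measureReal_le μ hK (h.finite _ _) fun j hj y hy => ?_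
      have h4 := (mem_nearCells.1 hj).2
      have h5 := hC.dist_le j (x j) (hx j) y hy
      rw [Metric.mem_ball, dist_comm]
      linarith [dist_triangle (x i) (x j) y]
    have hann := h.annulus (x i) hxi r (r + 6 * ε) (by linarith) (by linarith) (by linarith)
    rw [hvi] at hann
    nlinarith

include h hC hK hx ht hε hr hR hRδ hρ in
/-- The cells whose neighbourhood meets that of a given cell lie in a ball of radius `3 * R`. -/
theorem sum_cells_not_disjoint_le {V : Finset ι} (hV : ∀ i ∈ V, C i ⊆ W) {i : ι} (hi : i ∈ V) :
    ∑ j ∈ V with ¬ Disjoint (insert i (nearCells x ρ i)) (insert j (nearCells x ρ j)),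
      t * μ.real (C j) ≤ t * (b * (3 * R) ^ d) := by
  have hxi := hV i hi (hx i)
  have hi1 := hr _ hxi
  have hi2 := hR _ hxi
  rw [← Finset.mul_sum]
  refine mul_le_mul_of_nonneg_left ?_ ht.le
  refine le_trans ?_ (h.upper (x i) (3 * R) (by linarith)
    (Metric.ball_subset_thickening_of_le hxi hRδ))
  refine hC.sum_measureReal_le μ hK (h.finite _ _) fun j hj y hy => ?_
  obtain ⟨hjV, hd⟩ := Finset.mem_filter.1 hj
  obtain ⟨k, hki, hkj⟩ := Finset.not_disjoint_iff.1 hd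
  have hins : ∀ i' ∈ V, k ∈ insert i' (nearCells x ρ i') → dist (x i') (x k) ≤ R + 4 * ε := by
    intro i' hi' hk
    have h1 := hr _ (hV i' hi' (hx i'))
    have h2 := hR _ (hV i' hi' (hx i'))
    have h3 := abs_le.1 (hρ i' (hV i' hi'))
    rcases Finset.mem_insert.1 hk with rfl | hk
    · rw [dist_self]; linarith
    · linarith [(mem_nearCells.1 hk).2]
  have h1 := hins i hi hki
  have h2 := hins j hjV hkj
  have h5 := hC.dist_le j (x j) (hx j) y hy
  rw [dist_comm] at h2
  rw [Metric.mem_ball, dist_comm]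
  linarith [dist_triangle4 (x i) (x k) (x j) y]

include h hv0 hv hC hK hx ht hε hγ hr hR hRδ hρ in
/-- If neither of two cells lies in the neighbourhood of the other, then the second neighbourhood
contains a ball of a quarter of its radius that the first one misses: centre it at distance half
the radius from the second marked point, on the far side of the first. -/
theorem le_sum_nearCells_union [NormedSpace ℝ E] {i j : ι} (hi : C i ⊆ W) (hj : C j ⊆ W)
    (hij : i ≠ j) (hij' : j ∉ nearCells x ρ i) :
    (1 + a / b / 4 ^ d) * (t * v) - 2 * γ ≤
      ∑ k ∈ nearCells x ρ i ∪ nearCells x ρ j, t * μ.real (C k) := by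
  have hxi := hi (hx i)
  have hxj := hj (hx j)
  have hi1 := hr _ hxi
  have hj1 := hr _ hxj
  have hj2 := hR _ hxj
  have hi3 := abs_le.1 (hρ i hi)
  have hj3 := abs_le.1 (hρ j hj)
  have hb := h.b_pos
  have ha := h.a_pos
  have hTi := abs_le.1 (abs_sum_nearCells_sub_le h hv0 hv hC hK hx ht hε hγ hr hR hRδ hρ hi)
  have hvj := h.le_mul_massRadius_pow hv0 hv hxj
  set ri := massRadius μ v (x i)
  set rj := massRadius μ v (x j)
  have hdist : ρ i < dist (x i) (x j) := by
    by_contra! hle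
    exact hij' (mem_nearCells.2 ⟨hij.symm, hle⟩)
  have hpos : 0 < dist (x i) (x j) := by linarith
  have hrj0 : 0 < rj := by linarith
  set D := dist (x i) (x j) with hD
  have hnorm : ‖x j - x i‖ = D := by rw [hD, dist_comm, dist_eq_norm]
  set z : E := x j + (rj / 2 / D) • (x j - x i) with hz
  have hzj : dist z (x j) = rj / 2 := by
    rw [hz, dist_eq_norm, add_sub_cancel_left, norm_smul, hnorm,
      Real.norm_of_nonneg (by positivity)]
    field_simp
  have hzi : dist z (x i) = D + rj / 2 := by
    have : z - x i = (1 + rj / 2 / D) • (x j - x i) := by rw [hz, add_smul, one_smul]; abel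
    rw [dist_eq_norm, this, norm_smul, hnorm, Real.norm_of_nonneg (by positivity)]
    field_simp
  have hsub : Metric.ball z (rj / 4) ⊆ Metric.ball (x j) rj :=
    Metric.ball_subset_ball' (by rw [hzj]; linarith)
  have hlow := h.lower z (rj / 4) (by linarith)
    (hsub.trans (Metric.ball_subset_thickening_of_le hxj (by linarith)))
  have hsum : μ.real (Metric.ball z (rj / 4)) ≤
      ∑ k ∈ nearCells x ρ j \ nearCells x ρ i, μ.real (C k) := by
    refine hC.le_sum_measureReal μ hK fun y hy => ?_
    obtain ⟨k, hk⟩ := hC.exists_mem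
      ((hsub.trans (Metric.ball_subset_thickening_of_le hxj (by linarith : rj ≤ δ))) hy)
    rw [Metric.mem_ball] at hy
    have hyk := hC.dist_le k y hk (x k) (hx k)
    refine ⟨k, Finset.mem_sdiff.2 ⟨mem_nearCells.2 ⟨?_, ?_⟩, fun hk' => ?_⟩, hk⟩
    · rintro rfl
      linarith [dist_triangle z y (x k), dist_comm y z]
    · linarith [dist_triangle4 (x j) z y (x k), dist_comm y z, dist_comm (x j) z]
    · have := (mem_nearCells.1 hk').2
      linarith [dist_triangle4 z y (x k) (x i), dist_comm y z, dist_comm (x i) (x k)]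
  rw [← Finset.union_sdiff_self_eq_union, Finset.sum_union Finset.disjoint_sdiff]
  have hfin : a / b / 4 ^ d * (t * v) ≤
      ∑ k ∈ nearCells x ρ j \ nearCells x ρ i, t * μ.real (C k) := by
    rw [← Finset.mul_sum]
    calc a / b / 4 ^ d * (t * v) ≤ a / b / 4 ^ d * (t * (b * rj ^ d)) := by gcongr
      _ = t * (a * (rj / 4) ^ d) := by rw [div_pow]; field_simp
      _ ≤ _ := by gcongr; exact hlow.trans hsum
  linarith

end CellEstimates

/-- The event that every point of `η` in `W` has another point within distance `r`, the radius
being allowed to depend on the point. -/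
def closePairsEvent {Ω E : Type*} [MeasurableSpace E] [PseudoMetricSpace E] (η : Ω → Measure E)
    (W : Set E) (r : E → ℝ) : Set Ω :=
  {ω | ∀ x ∈ points (η ω) ∩ W, ∃ y ∈ points (η ω), y ≠ x ∧ dist x y ≤ r x}

section Sandwich

variable {E : Type*} [NormedAddCommGroup E] [MeasurableSpace E] [BorelSpace E]
  [SecondCountableTopology E] {W : Set E} {δ : ℝ} {r : E → ℝ}
  {ι : Type*} [Fintype ι] [DecidableEq ι] {C : ι → Set E} {ε : ℝ}
  (hC : IsCellPartition C (Metric.thickening δ W) W ε)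
  {x : ι → E} (hx : ∀ i, x i ∈ C i)
  (hlip : ∀ y ∈ W, ∀ z ∈ W, r y ≤ r z + dist y z)
  {Ω : Type*} {η : Ω → Measure E} (hη : ∀ ω, IsLocFinCounting (η ω))
  {V : Finset ι} (hV : ∀ i, i ∈ V ↔ C i ⊆ W)

include hC hx hlip hη hV

/-- The radii are reduced by `3 * ε` because replacing a nucleus and another point by the marked
points of their cells, and the critical radius at the nucleus by that at the marked point, costs at
most `ε` each. -/
theorem no_isolatedEvent_subset_closePairsEvent (hWδ : W ⊆ Metric.thickening δ W) :
    {ω | ∀ i ∈ V, ω ∉ isolatedEvent (fun j => {ω | η ω (C j) ≠ 0})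
      (nearCells x fun i => r (x i) - 3 * ε) i} ⊆ closePairsEvent η W r := by
  rintro ω hω y ⟨hy, hyW⟩
  obtain ⟨i, hi⟩ := hC.exists_mem (hWδ hyW)
  have hiW := hC.subset_of_mem hi hyW
  have hyi : η ω (C i) ≠ 0 := fun h0 => hy (measure_mono_null (by simpa using hi) h0)
  have := hω i ((hV i).2 hiW)
  simp only [isolatedEvent, Set.mem_inter_iff, Set.mem_ofPred_eq, Set.mem_iInter,
    Set.mem_compl_iff, not_and, not_forall, not_not] at this
  obtain ⟨j, hj, hj0⟩ := this hyi
  obtain ⟨hji, hdist⟩ := mem_nearCells.1 hj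
  obtain ⟨z, hzj, hz⟩ := (hη ω).exists_mem_points hj0
  refine ⟨z, hz, ?_, ?_⟩
  · rintro rfl
    exact hji (hC.eq_of_mem hzj hi)
  · have h1 := hC.dist_le i y hi (x i) (hx i)
    have h2 := hC.dist_le j (x j) (hx j) z hzj
    have h3 := hlip (x i) (hiW (hx i)) y hyW
    linarith [dist_triangle4 y (x i) (x j) z, dist_comm y (x i)]

/-- The converse inclusion, with radii enlarged by `3 * ε`, holds unless some cell in `W` contains
two points: then an isolated cell may have its nucleus close to another point of the same cell. -/
theorem closePairsEvent_subset (hrδ : ∀ y ∈ W, r y < δ) :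
    closePairsEvent η W r ⊆ {ω | ∀ i ∈ V, ω ∉ isolatedEvent (fun j => {ω | η ω (C j) ≠ 0})
      (nearCells x fun i => r (x i) + 3 * ε) i} ∪ ⋃ i ∈ V, {ω | 1 < η ω (C i)} := by
  intro ω hω
  by_cases hbad : ω ∈ ⋃ i ∈ V, {ω | 1 < η ω (C i)}
  · exact Or.inr hbad
  refine Or.inl fun i hi hiso => ?_
  simp only [Set.mem_iUnion, Set.mem_ofPred_eq, not_exists, not_lt] at hbad
  simp only [isolatedEvent, Set.mem_inter_iff, Set.mem_ofPred_eq, Set.mem_iInter,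
    Set.mem_compl_iff, not_not] at hiso
  have hiW := (hV i).1 hi
  obtain ⟨y, hyi, hy⟩ := (hη ω).exists_mem_points hiso.1
  obtain ⟨z, hz, hzy, hdist⟩ := hω y ⟨hy, hiW hyi⟩
  have hzK : z ∈ Metric.thickening δ W :=
    Metric.mem_thickening_iff.2 ⟨y, hiW hyi, by
      rw [dist_comm]; exact hdist.trans_lt (hrδ y (hiW hyi))⟩
  obtain ⟨j, hj⟩ := hC.exists_mem hzK
  have hji : j ≠ i := by
    rintro rfl
    exact hzy ((hη ω).eq_of_mem_points (hbad j hi) hj hyi hz hy)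
  have h1 := hC.dist_le i (x i) (hx i) y hyi
  have h2 := hC.dist_le j z hj (x j) (hx j)
  have h3 := hlip y (hiW hyi) (x i) (hiW (hx i))
  have h4 := hiso.2 j (mem_nearCells.2 ⟨hji, by
    linarith [dist_triangle4 (x i) y z (x j), dist_comm y (x i)]⟩)
  exact hz (measure_mono_null (by simpa using hj) h4)

end Sandwich

section PoissonEstimate

variable {E : Type*} [NormedAddCommGroup E] [NormedSpace ℝ E] [FiniteDimensional ℝ E]
  [MeasurableSpace E] [BorelSpace E]

/-- The quantitative Poisson approximation at a fixed intensity. The number of isolated nuclei in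
`W` has expectation `t * exp (-(t * v))`. The first error term comes from the discretisation of this
expectation, the next two are the Chen–Stein terms, and the last one bounds the probability that
some cell in `W` contains two points. -/
theorem abs_measureReal_closePairsEvent_sub_le {μ : Measure E} {W : Set E} {d : ℕ} {δ a b L : ℝ}
    (h : RegularNear μ W d δ a b L) (hW : IsCompact W) (hμW : μ W = 1)
    {Ω : Type*} [MeasurableSpace Ω] {P : Measure Ω} [IsProbabilityMeasure P] {t : ℝ} (ht : 0 < t)
    {η : Ω → Measure E} (hη : IsPoissonProcess P (ENNReal.ofReal t • μ) η)
    {v : ℝ} (hv0 : 0 < v) (hv : v ≤ a * δ ^ d) {γ R ρ : ℝ} (hγ0 : 0 < γ) (hγ1 : γ ≤ 1)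
    (hρ0 : 0 < ρ) (hρ : ∀ y ∈ W, ρ ≤ massRadius μ v y)
    (hR : ∀ y ∈ W, massRadius μ v y ≤ R) (hRδ : 3 * R ≤ δ) :
    |P.real (closePairsEvent η W (massRadius μ v)) - Real.exp (-(t * Real.exp (-(t * v))))| ≤
      t * Real.exp (-(t * v)) * (Real.exp (2 * γ) - (1 - γ) * Real.exp (-(2 * γ))) +
        t * (t * (b * (3 * R) ^ d)) * Real.exp (-(t * v) + 2 * γ) ^ 2 +
        t * (t * (b * (3 * R) ^ d)) *
          Real.exp (-((1 + a / b / 4 ^ d) * (t * v)) + 2 * γ) + γ * t := by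
  classical
  have : ProperSpace E := FiniteDimensional.proper_real E
  have hWne : W.Nonempty := nonempty_of_measure_ne_zero (by rw [hμW]; exact one_ne_zero)
  have hL := h.L_pos
  -- a mesh so fine that the annuli of width `6 * ε` have expected mass at most `γ`
  obtain ⟨ε, hε, hεγ, hερ⟩ : ∃ ε : ℝ, 0 < ε ∧ t * L * (6 * ε) ≤ γ ∧ 40 * ε ≤ ρ := by
    refine ⟨min (γ / (6 * t * L)) (ρ / 40), by positivity, ?_, ?_⟩
    · calc t * L * (6 * min (γ / (6 * t * L)) (ρ / 40))
          ≤ t * L * (6 * (γ / (6 * t * L))) := by gcongr; exact min_le_left _ _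
        _ = γ := by field_simp
    · linarith [min_le_right (γ / (6 * t * L)) (ρ / 40)]
  set K := Metric.thickening δ W with hKdef
  have hKb : Bornology.IsBounded K := hW.isBounded.thickening
  have hKfin : μ K ≠ ∞ := by
    obtain ⟨r, hr⟩ := hKb.subset_ball 0
    exact measure_ne_top_of_subset hr (h.finite 0 r)
  obtain ⟨ι, _, C, hC⟩ := exists_isCellPartition (W := W)
    Metric.isOpen_thickening.measurableSet hKb hW.measurableSet hε
  choose x hx using hC.nonempty
  set V : Finset ι := {i | C i ⊆ W} with hVdef
  have hV : ∀ i, i ∈ V ↔ C i ⊆ W := by simp [hVdef]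
  have hr : ∀ y ∈ W, 40 * ε ≤ massRadius μ v y := fun y hy => hερ.trans (hρ y hy)
  have hΛ : ∀ B, (ENNReal.ofReal t • μ).real B = t * μ.real B := by
    intro B
    simp [measureReal_def, ENNReal.toReal_ofReal ht.le]
  have hΛfin : ∀ i, (ENNReal.ofReal t • μ) (C i) ≠ ∞ := fun i => by
    simpa using ENNReal.mul_ne_top ENNReal.ofReal_ne_top (hC.measure_ne_top μ hKfin i)
  set A : ι → Set Ω := fun j => {ω | η ω (C j) ≠ 0} with hA
  set m : ι → ℝ := fun j => t * μ.real (C j) with hm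
  have hWK : W ⊆ K := Metric.self_subset_thickening h.δ_pos W
  have hVsum : ∑ i ∈ V, m i = t := by
    have h1 : μ.real W = 1 := by simp [measureReal_def, hμW]
    have h2 : ∑ i ∈ V, μ.real (C i) = μ.real W := by
      refine le_antisymm (hC.sum_measureReal_le μ hKfin (by simp [hμW]) fun i hi => (hV i).1 hi)
        (hC.le_sum_measureReal μ hKfin fun y hy => ?_)
      obtain ⟨i, hi⟩ := hC.exists_mem (hWK hy)
      exact ⟨i, (hV i).2 (hC.subset_of_mem hi hy), hi⟩
    rw [← Finset.mul_sum, h2, h1, mul_one]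
  have hmγ : ∀ i ∈ V, m i ≤ γ := fun i hi =>
    mul_measureReal_cell_le h hC hx ht hε hεγ hr hR hRδ ((hV i).1 hi)
  have hm0 : ∀ i, 0 ≤ m i := fun i => mul_nonneg ht.le measureReal_nonneg
  have hAmeas : ∀ i, MeasurableSet (A i) := fun i =>
    hη.measurable_apply (hC.measurableSet i) (measurableSet_singleton 0).compl
  have hAm : ∀ i, P.real (A i)ᶜ = Real.exp (-m i) := fun i => by
    rw [hη.measureReal_eq_zero (hC.measurableSet i) (hΛfin i), hΛ]
  have key : ∀ ρ : ι → ℝ, (∀ i, C i ⊆ W → |ρ i - massRadius μ v (x i)| ≤ 4 * ε) → _ := fun ρ hρ =>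
    abs_measureReal_no_isolatedEvent_sub_exp_le (T := nearCells x ρ) (l := t * v)
      (c := a / b / 4 ^ d) hAmeas
      (hη.iIndepSet_ne_zero hC.measurableSet hC.disjoint) hAm hm0
      (fun i => by simp [mem_nearCells]) V hγ1 hVsum hmγ
      (fun i hi => abs_sum_nearCells_sub_le h hv0 hv hC hKfin hx ht hε hεγ hr hR hRδ hρ
        ((hV i).1 hi))
      (fun i hi => sum_cells_not_disjoint_le h hC hKfin hx ht hε hr hR hRδ hρ
        (fun i hi => (hV i).1 hi) hi)
      (fun i hi j hj hij _ hij' => le_sum_nearCells_union h hv0 hv hC hKfin hx ht hε hεγ hr hR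
        hRδ hρ ((hV i).1 hi) ((hV j).1 hj) hij hij')
  have hlip : ∀ y ∈ W, ∀ z ∈ W, massRadius μ v y ≤ massRadius μ v z + dist y z :=
    fun y _ z hz => h.massRadius_le_add_dist hv0 hv y hz
  have hlow := measureReal_mono (μ := P)
    (no_isolatedEvent_subset_closePairsEvent hC hx hlip hη.counting hV hWK)
  have hup := measureReal_mono (μ := P) (closePairsEvent_subset hC hx hlip hη.counting hV
    fun y hy => by linarith [hR y hy, hr y hy])
  have hbad : P.real (⋃ i ∈ V, {ω | 1 < η ω (C i)}) ≤ γ * t := by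
    refine (measureReal_biUnion_finset_le _ _).trans ?_
    rw [← hVsum, Finset.mul_sum]
    refine Finset.sum_le_sum fun i hi => ?_
    refine (hη.measureReal_one_lt_le (hC.measurableSet i) (hΛfin i)).trans ?_
    rw [hΛ, sq]
    exact mul_le_mul_of_nonneg_right (hmγ i hi) (hm0 i)
  have hup' := hup.trans (measureReal_union_le _ _)
  have k1 := abs_le.1 (key (fun i => massRadius μ v (x i) - 3 * ε) fun i _ => by
    rw [sub_sub_cancel_left, abs_neg, abs_of_pos (by linarith)]; linarith)
  have k2 := abs_le.1 (key (fun i => massRadius μ v (x i) + 3 * ε) fun i _ => by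
    rw [add_sub_cancel_left, abs_of_pos (by linarith)]; linarith)
  have hγt : 0 ≤ γ * t := by positivity
  rw [abs_le]
  constructor <;> linarith [k1.1, k2.2]

end PoissonEstimate

/-! ### Measures with a density, and the inradius -/

section Density

variable {E : Type*} [MeasureSpace E] {f : E → ℝ≥0}

theorem withDensity_real_le {B : Set E} (hB : MeasurableSet B) (hBfin : volume B ≠ ∞) {M : ℝ≥0}
    (h : ∀ x ∈ B, f x ≤ M) :
    (volume.withDensity fun x => (f x : ℝ≥0∞)).real B ≤ M * volume.real B := by
  have h1 : (volume.withDensity fun x => (f x : ℝ≥0∞)) B ≤ M * volume B := by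
    rw [withDensity_apply _ hB, ← setLIntegral_const]
    exact setLIntegral_mono measurable_const fun x hx => by exact_mod_cast h x hx
  have h2 := ENNReal.toReal_mono (ENNReal.mul_ne_top ENNReal.coe_ne_top hBfin) h1
  simpa [measureReal_def] using h2

theorem le_withDensity_real (hf : Measurable f) {B : Set E} (hB : MeasurableSet B)
    (hBfin : (volume.withDensity fun x => (f x : ℝ≥0∞)) B ≠ ∞) {M : ℝ≥0}
    (h : ∀ x ∈ B, M ≤ f x) :
    M * volume.real B ≤ (volume.withDensity fun x => (f x : ℝ≥0∞)).real B := by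
  have h1 : M * volume B ≤ (volume.withDensity fun x => (f x : ℝ≥0∞)) B := by
    rw [withDensity_apply _ hB, ← setLIntegral_const]
    exact setLIntegral_mono (by fun_prop) fun x hx => by exact_mod_cast h x hx
  have h2 := ENNReal.toReal_mono hBfin h1
  simpa [measureReal_def] using h2

end Density

theorem pow_sub_pow_le_mul_sub {r s : ℝ} (hs : 0 ≤ s) (hsr : s ≤ r) (hr : r ≤ 1) (n : ℕ) :
    r ^ n - s ^ n ≤ n * (r - s) := by
  induction n with
  | zero => simp
  | succ n ih =>
    have h1 : 0 ≤ r ^ n - s ^ n := sub_nonneg.2 (pow_le_pow_left₀ hs hsr n)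
    have h2 : s ^ n ≤ 1 := pow_le_one₀ hs (hsr.trans hr)
    have h3 : r ^ (n + 1) - s ^ (n + 1) = r * (r ^ n - s ^ n) + s ^ n * (r - s) := by ring
    rw [h3]
    push_cast
    nlinarith

theorem volume_real_ball_eq {d : ℕ} (x : EuclideanSpace ℝ (Fin d)) {r : ℝ} (hr : 0 ≤ r)
    (hd : 1 ≤ d) : volume.real (Metric.ball x r) =
      volume.real (Metric.ball (0 : EuclideanSpace ℝ (Fin d)) 1) * r ^ d := by
  have : Nonempty (Fin d) := ⟨⟨0, hd⟩⟩
  rw [measureReal_def, Measure.addHaar_ball _ x hr, ENNReal.toReal_mul, finrank_euclideanSpace_fin,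
    ENNReal.toReal_ofReal (by positivity), mul_comm]
  rfl

theorem volume_real_unitBall_pos (d : ℕ) :
    0 < volume.real (Metric.ball (0 : EuclideanSpace ℝ (Fin d)) 1) :=
  ENNReal.toReal_pos (Metric.measure_ball_pos _ _ one_pos).ne' measure_ball_lt_top.ne

/-- A density bounded above and away from zero near `W` makes the measure regular near `W`. The
scale is taken at most `1` so that `r ^ d - s ^ d ≤ d * (r - s)` for the radii of annuli. -/
theorem exists_regularNear {d : ℕ} (hd : 1 ≤ d)
    {f : EuclideanSpace ℝ (Fin d) → ℝ≥0} (hf : Measurable f)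
    {μ : Measure (EuclideanSpace ℝ (Fin d))}
    (hμ : μ = volume.withDensity (fun x => (f x : ℝ≥0∞))) (hμfin : IsLocallyFiniteMeasure μ)
    {W : Set (EuclideanSpace ℝ (Fin d))} (hW : IsCompact W) (hWne : W.Nonempty)
    {A : Set (EuclideanSpace ℝ (Fin d))} (hA : IsOpen A) (hWA : W ⊆ A)
    {fmin fmax : ℝ≥0} (hmin0 : 0 < fmin) (hmin : ∀ x ∈ A, fmin ≤ f x)
    (hmax : ∀ x ∈ A, f x ≤ fmax) :
    ∃ δ a b L : ℝ, RegularNear μ W d δ a b L := by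
  obtain ⟨δ', hδ', hsub⟩ := hW.exists_thickening_subset_open hA hWA
  set κ := volume.real (Metric.ball (0 : EuclideanSpace ℝ (Fin d)) 1) with hκ
  have hκ0 : 0 < κ := volume_real_unitBall_pos d
  have hmax0 : 0 < fmax := by
    obtain ⟨x, hx⟩ := hWne
    exact hmin0.trans_le ((hmin x (hWA hx)).trans (hmax x (hWA hx)))
  have hmin0' : (0 : ℝ) < fmin := hmin0
  have hmax0' : (0 : ℝ) < fmax := hmax0
  have hd' : (0 : ℝ) < d := by exact_mod_cast hd
  have hfin : ∀ x r, μ (Metric.ball x r) ≠ ∞ := fun x r => measure_ball_lt_top.ne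
  have hKA : Metric.thickening (min δ' 1) W ⊆ A :=
    (Metric.thickening_mono (min_le_left _ _) W).trans hsub
  refine ⟨min δ' 1, fmin * κ, fmax * κ, fmax * (κ * d), hfin, by positivity, by positivity,
    by positivity, by positivity, fun z r hr hz => ?_, fun z r hr hz => ?_,
    fun x hx s r hs hsr hr => ?_⟩
  · rw [mul_assoc, hκ, ← volume_real_ball_eq z hr hd, hμ]
    exact le_withDensity_real hf Metric.isOpen_ball.measurableSet (hμ ▸ hfin z r)
      fun y hy => hmin y (hKA (hz hy))
  · rw [mul_assoc, hκ, ← volume_real_ball_eq z hr hd, hμ]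
    exact withDensity_real_le Metric.isOpen_ball.measurableSet measure_ball_lt_top.ne
      fun y hy => hmax y (hKA (hz hy))
  · have hss : Metric.ball x s ⊆ Metric.ball x r := Metric.ball_subset_ball hsr
    have h1 : μ.real (Metric.ball x r \ Metric.ball x s) ≤
        fmax * volume.real (Metric.ball x r \ Metric.ball x s) := by
      rw [hμ]
      refine withDensity_real_le
        (Metric.isOpen_ball.measurableSet.diff Metric.isOpen_ball.measurableSet)
        (measure_ne_top_of_subset Set.sdiff_subset measure_ball_lt_top.ne) fun y hy => hmax y ?_
      exact hKA (Metric.ball_subset_thickening_of_le hx hr hy.1)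
    rw [measureReal_sdiff hss Metric.isOpen_ball.measurableSet measure_ball_lt_top.ne,
      measureReal_sdiff hss Metric.isOpen_ball.measurableSet measure_ball_lt_top.ne,
      volume_real_ball_eq x (hs.trans hsr) hd, volume_real_ball_eq x hs hd, ← mul_sub] at h1
    have h2 := pow_sub_pow_le_mul_sub hs hsr (hr.trans (min_le_right _ _)) d
    have h3 : fmax * (κ * (r ^ d - s ^ d)) ≤ fmax * (κ * (d * (r - s))) := by gcongr
    linarith

/-- Halving the radius of a small ball divides its measure by about `2 ^ d` if the density is
Hölder continuous. -/
theorem HolderWith.abs_two_pow_mul_withDensity_ball_sub_le {d : ℕ} (hd : 1 ≤ d)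
    {f : EuclideanSpace ℝ (Fin d) → ℝ≥0} {C β : ℝ≥0} (hH : HolderWith C β f) (hf : Measurable f)
    {μ : Measure (EuclideanSpace ℝ (Fin d))}
    (hμ : μ = volume.withDensity (fun x => (f x : ℝ≥0∞)))
    (hfin : ∀ x r, μ (Metric.ball x r) ≠ ∞) (x : EuclideanSpace ℝ (Fin d)) {r : ℝ} (hr : 0 ≤ r) :
    |2 ^ d * μ.real (Metric.ball x (r / 2)) - μ.real (Metric.ball x r)| ≤
      2 * (C * r ^ (β : ℝ)) * volume.real (Metric.ball (0 : EuclideanSpace ℝ (Fin d)) 1) *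
        r ^ d := by
  set κ := volume.real (Metric.ball (0 : EuclideanSpace ℝ (Fin d)) 1) with hκ
  set e : ℝ := C * r ^ (β : ℝ) with he
  have hκ0 : 0 < κ := volume_real_unitBall_pos d
  have he0 : 0 ≤ e := by positivity
  have hclose : ∀ y ∈ Metric.ball x r, |(f y : ℝ) - f x| ≤ e := by
    intro y hy
    rw [← NNReal.dist_eq]
    exact hH.dist_le_of_le hy.le
  -- on every smaller concentric ball, `μ` is within `e` of `f x` times the volume
  have hball : ∀ s, 0 ≤ s → s ≤ r → |μ.real (Metric.ball x s) - f x * (κ * s ^ d)| ≤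
      e * (κ * s ^ d) := by
    intro s hs hsr
    have hss := Metric.ball_subset_ball (x := x) hsr
    have hup := withDensity_real_le (f := f) (B := Metric.ball x s) (M := (f x + e).toNNReal)
      Metric.isOpen_ball.measurableSet measure_ball_lt_top.ne fun y hy => by
        refine (Real.le_toNNReal_iff_coe_le (by positivity)).2 ?_
        linarith [(abs_le.1 (hclose y (hss hy))).2]
    have hlo := le_withDensity_real (B := Metric.ball x s)
      (M := (f x - e).toNNReal) hf Metric.isOpen_ball.measurableSet (hμ ▸ hfin x s) fun y hy => by
        rw [Real.toNNReal_le_iff_le_coe]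
        linarith [(abs_le.1 (hclose y (hss hy))).1]
    rw [← hμ, volume_real_ball_eq x hs hd] at hup hlo
    rw [Real.coe_toNNReal _ (by positivity)] at hup
    have hlo' : (f x - e) * (κ * s ^ d) ≤ μ.real (Metric.ball x s) :=
      le_trans (mul_le_mul_of_nonneg_right (Real.le_coe_toNNReal _) (by positivity)) hlo
    rw [abs_le]
    constructor <;> linarith
  have h1 := abs_le.1 (hball r hr le_rfl)
  have h2 := abs_le.1 (hball (r / 2) (by linarith) (by linarith))
  have h3 : (2 : ℝ) ^ d * (r / 2) ^ d = r ^ d := by rw [← mul_pow]; congr 1; ring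
  have h4 : (2 : ℝ) ^ d * (f x * (κ * (r / 2) ^ d)) = f x * (κ * r ^ d) := by rw [← h3]; ring
  have h5 : (2 : ℝ) ^ d * (e * (κ * (r / 2) ^ d)) = e * (κ * r ^ d) := by rw [← h3]; ring
  have h6 : (0 : ℝ) < 2 ^ d := by positivity
  rw [abs_le]
  constructor <;> nlinarith

section Inradius

variable {d : ℕ} {x : EuclideanSpace ℝ (Fin d)} {ν : Measure (EuclideanSpace ℝ (Fin d))}

theorem inradius_le_half_dist {y : EuclideanSpace ℝ (Fin d)} (hy : y ∈ points ν) (hyx : y ≠ x) :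
    inradius x ν ≤ ENNReal.ofReal (dist x y / 2) := by
  refine sSup_le ?_
  rintro _ ⟨R, rfl, hR⟩
  rw [← ENNReal.ofReal_coe_nnreal]
  refine ENNReal.ofReal_le_ofReal ?_
  by_contra! hlt
  have hD : 0 < dist x y := dist_pos.2 hyx.symm
  set D := dist x y with hDdef
  -- a point of the segment from `x` to `y` beyond its midpoint but within distance `R` of `x`
  obtain ⟨q, hq1, hq2⟩ := exists_between (lt_min hlt (by linarith : D / 2 < D))
  rw [lt_min_iff] at hq2
  have hnorm : ‖y - x‖ = D := by rw [hDdef, dist_comm, dist_eq_norm]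
  set p := x + (q / D) • (y - x) with hp
  have hpx : ‖x - p‖ = q := by
    rw [hp, sub_add_cancel_left, norm_neg, norm_smul, hnorm,
      Real.norm_of_nonneg (div_nonneg (by linarith) hD.le)]
    field_simp
  have hpy : ‖p - y‖ = D - q := by
    have : p - y = -((1 - q / D) • (y - x)) := by rw [hp, sub_smul, one_smul]; abel
    rw [this, norm_neg, norm_smul, hnorm,
      Real.norm_of_nonneg (sub_nonneg.2 ((div_le_one hD).2 hq2.2.le))]
    field_simp
  have hpR : p ∈ Metric.ball x (R : ℝ) := by
    rw [Metric.mem_ball, dist_comm, dist_eq_norm, hpx]; exact hq2.1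
  have := hR hpR y hy hyx
  rw [hpx, hpy] at this
  linarith

theorem half_le_inradius {r : ℝ} (h : ∀ y ∈ points ν, y ≠ x → r ≤ dist x y) :
    ENNReal.ofReal (r / 2) ≤ inradius x ν := by
  refine le_sSup ⟨(r / 2).toNNReal, rfl, fun p hp y hy hyx => ?_⟩
  rcases le_or_gt r 0 with hr | hr
  · simp [Real.toNNReal_of_nonpos (by linarith : r / 2 ≤ 0)] at hp
  rw [Metric.mem_ball, Real.coe_toNNReal _ (by linarith)] at hp
  have := h y hy hyx
  rw [← dist_eq_norm, ← dist_eq_norm]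
  linarith [dist_triangle x p y, dist_comm x p]

theorem EReal.coe_ennreal_sub_le_iff {X : ℝ≥0∞} {s u : ℝ} (h : 0 ≤ s + u) :
    (X : EReal) - (s : EReal) ≤ (u : EReal) ↔ X ≤ ENNReal.ofReal (s + u) := by
  rw [EReal.sub_le_iff_le_add (by simp) (by simp), add_comm, ← EReal.coe_add,
    ← EReal.coe_ennreal_le_coe_ennreal_iff, EReal.coe_ennreal_ofReal, max_eq_left h]

variable {Ω : Type*} {η : Ω → Measure (EuclideanSpace ℝ (Fin d))}
  {W : Set (EuclideanSpace ℝ (Fin d))} {r : EuclideanSpace ℝ (Fin d) → ℝ}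
  {G : EuclideanSpace ℝ (Fin d) → ℝ≥0∞ → ℝ≥0∞} {s u : ℝ}

theorem closePairsEvent_subset_iSup_le (hG : ∀ x, Monotone (G x)) (hsu : 0 ≤ s + u)
    (hr : ∀ x ∈ W, G x (ENNReal.ofReal (r x / 2)) ≤ ENNReal.ofReal (s + u)) :
    closePairsEvent η W r ⊆
      {ω | (⨆ x ∈ points (η ω) ∩ W, ((G x (inradius x (η ω)) : ℝ≥0∞) : EReal) - (s : EReal)) ≤
        (u : EReal)} := by
  intro ω hω
  refine iSup₂_le fun x hx => (EReal.coe_ennreal_sub_le_iff hsu).2 ?_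
  obtain ⟨y, hy, hyx, hdist⟩ := hω x hx
  refine (hG x ?_).trans (hr x hx.2)
  exact (inradius_le_half_dist hy hyx).trans (ENNReal.ofReal_le_ofReal (by linarith))

theorem iSup_le_subset_closePairsEvent (hG : ∀ x, Monotone (G x)) (hsu : 0 ≤ s + u)
    (hr : ∀ x ∈ W, ENNReal.ofReal (s + u) < G x (ENNReal.ofReal (r x / 2))) :
    {ω | (⨆ x ∈ points (η ω) ∩ W, ((G x (inradius x (η ω)) : ℝ≥0∞) : EReal) - (s : EReal)) ≤
        (u : EReal)} ⊆
      closePairsEvent η W r := by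
  intro ω hω x hx
  by_contra! hcon
  rw [Set.mem_ofPred_eq, iSup₂_le_iff] at hω
  have h1 := (EReal.coe_ennreal_sub_le_iff hsu).1 (hω x hx)
  have h2 : ENNReal.ofReal (r x / 2) ≤ inradius x (η ω) :=
    half_le_inradius fun y hy hyx => (hcon y hy hyx).le
  exact absurd ((hr x hx.2).trans_le (hG x h2)) (not_lt.2 h1)

end Inradius

/-! ### Convergence to the Gumbel law -/

/-- The mass `(log t + u) / t` that a ball around a nucleus must have for its scaled and centred
mass to equal `u`. -/
noncomputable def criticalMass (u t : ℝ) : ℝ := (Real.log t + u) / t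

theorem tendsto_log_add_atTop (u : ℝ) : Tendsto (fun t => Real.log t + u) atTop atTop :=
  tendsto_atTop_add_const_right _ _ Real.tendsto_log_atTop

theorem mul_criticalMass {u t : ℝ} (ht : 0 < t) : t * criticalMass u t = Real.log t + u := by
  unfold criticalMass; field_simp

theorem mul_exp_neg_log_add {u t : ℝ} (ht : 0 < t) :
    t * Real.exp (-(Real.log t + u)) = Real.exp (-u) := by
  rw [neg_add, Real.exp_add, Real.exp_neg, Real.exp_log ht]
  field_simp

/-- `l * criticalMass ^ β` tends to `0`, where `l = log t + u` and hence `t = exp (l - u)`. -/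
theorem tendsto_mul_criticalMass_rpow (u : ℝ) {β : ℝ} (hβ : 0 < β) :
    Tendsto (fun t => (Real.log t + u) * criticalMass u t ^ β) atTop (𝓝 0) := by
  have h1 : Tendsto (fun l : ℝ => Real.exp (β * u) * (l ^ (1 + β) * Real.exp (-β * l)))
      atTop (𝓝 0) := by
    simpa using (tendsto_rpow_mul_exp_neg_mul_atTop_nhds_zero (1 + β) β hβ).const_mul
      (Real.exp (β * u))
  refine (h1.comp (tendsto_log_add_atTop u)).congr' ?_
  filter_upwards [eventually_gt_atTop 0, (tendsto_log_add_atTop u).eventually_gt_atTop 0]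
    with t ht hl
  have h2 : criticalMass u t = (Real.log t + u) * Real.exp (-(Real.log t + u) + u) := by
    rw [criticalMass, neg_add_rev, add_right_comm, neg_add_cancel, zero_add, Real.exp_neg,
      Real.exp_log ht, div_eq_mul_inv]
  simp only [Function.comp]
  have h3 : Real.exp ((-(Real.log t + u) + u) * β) =
      Real.exp (β * u) * Real.exp (-β * (Real.log t + u)) := by
    rw [← Real.exp_add]; congr 1; ring
  rw [h2, Real.mul_rpow hl.le (Real.exp_pos _).le, ← Real.exp_mul, h3, Real.rpow_add hl,
    Real.rpow_one]
  ring

theorem tendsto_criticalMass (u : ℝ) : Tendsto (criticalMass u) atTop (𝓝 0) := by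
  have h1 := tendsto_mul_criticalMass_rpow u one_pos
  refine squeeze_zero' ?_ ?_ h1
  · filter_upwards [eventually_gt_atTop 0, (tendsto_log_add_atTop u).eventually_gt_atTop 0]
      with t ht hl
    exact (div_pos hl ht).le
  · filter_upwards [eventually_gt_atTop 0, (tendsto_log_add_atTop u).eventually_ge_atTop 1]
      with t ht hl
    rw [Real.rpow_one]
    exact le_mul_of_one_le_left (div_pos (by linarith) ht).le hl

namespace RegularNear

variable {E : Type*} [NormedAddCommGroup E] [MeasurableSpace E]
  {μ : Measure E} {W : Set E} {d : ℕ} {δ a b L : ℝ} (h : RegularNear μ W d δ a b L)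
include h

theorem massRadius_le_rpow (hd : 1 ≤ d) {v : ℝ} (hv0 : 0 < v) (hv : v ≤ a * δ ^ d) {x : E}
    (hx : x ∈ W) : massRadius μ v x ≤ (v / a) ^ (1 / d : ℝ) := by
  have ha := h.a_pos
  rw [one_div, Real.le_rpow_inv_iff_of_pos (massRadius_nonneg _ _ _) (by positivity)
    (by positivity), Real.rpow_natCast, le_div_iff₀' ha]
  exact h.mul_massRadius_pow_le hv0 hv hx

theorem rpow_le_massRadius (hd : 1 ≤ d) {v : ℝ} (hv0 : 0 < v) (hv : v ≤ a * δ ^ d) {x : E}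
    (hx : x ∈ W) : (v / b) ^ (1 / d : ℝ) ≤ massRadius μ v x := by
  have hb := h.b_pos
  rw [one_div, Real.rpow_inv_le_iff_of_pos (by positivity) (massRadius_nonneg _ _ _)
    (by positivity), Real.rpow_natCast, div_le_iff₀' hb]
  exact h.le_mul_massRadius_pow hv0 hv hx

theorem eventually_criticalMass (u : ℝ) :
    ∀ᶠ t in atTop, 0 < t ∧ 0 < criticalMass u t ∧ criticalMass u t ≤ a * δ ^ d := by
  have ha := h.a_pos
  have hδ := h.δ_pos
  filter_upwards [eventually_gt_atTop 0, (tendsto_log_add_atTop u).eventually_gt_atTop 0,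
    (tendsto_criticalMass u).eventually_le_const (show 0 < a * δ ^ d by positivity)] with t ht hl hv
  exact ⟨ht, div_pos hl ht, hv⟩

end RegularNear

section Limits

variable {E : Type*} [NormedAddCommGroup E] [NormedSpace ℝ E] [FiniteDimensional ℝ E]
  [MeasurableSpace E] [BorelSpace E]

theorem tendsto_measureReal_closePairsEvent {μ : Measure E} {W : Set E} {d : ℕ} (hd : 1 ≤ d)
    {δ a b L : ℝ} (h : RegularNear μ W d δ a b L) (hW : IsCompact W) (hμW : μ W = 1)
    {Ω : Type*} [MeasurableSpace Ω] {P : Measure Ω} [IsProbabilityMeasure P]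
    {η : ℝ → Ω → Measure E}
    (hη : ∀ t : ℝ, 0 < t → IsPoissonProcess P (ENNReal.ofReal t • μ) (η t)) (u : ℝ) :
    Tendsto (fun t => P.real (closePairsEvent (η t) W (massRadius μ (criticalMass u t))))
      atTop (𝓝 (Real.exp (-Real.exp (-u)))) := by
  have ha := h.a_pos
  have hb := h.b_pos
  have hd' : (0 : ℝ) < d := by exact_mod_cast hd
  set c : ℝ := a / b / 4 ^ d with hc
  have hc0 : 0 < c := by positivity
  set Q : ℝ := 3 ^ d * b / a with hQ
  -- the mesh is chosen such that `γ * t`, the bound for cells with two points, also tends to `0`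
  set γ : ℝ → ℝ := fun t => (t ^ 2)⁻¹ with hγ
  have hγlim : Tendsto γ atTop (𝓝 0) :=
    tendsto_inv_atTop_zero.comp (tendsto_pow_atTop two_ne_zero)
  set F : ℝ → ℝ := fun t => Real.exp (-u) *
      (Real.exp (2 * γ t) - (1 - γ t) * Real.exp (-(2 * γ t))) +
    Q * Real.exp (-u) * Real.exp (2 * γ t) ^ 2 *
      ((Real.log t + u) ^ (1 : ℝ) * Real.exp (-1 * (Real.log t + u))) +
    Q * Real.exp (-u) * Real.exp (2 * γ t) *
      ((Real.log t + u) ^ (1 : ℝ) * Real.exp (-c * (Real.log t + u))) + t⁻¹ with hF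
  have hFlim : Tendsto F atTop (𝓝 0) := by
    have e1 : Tendsto (fun t => Real.exp (2 * γ t)) atTop (𝓝 1) := by
      simpa using (hγlim.const_mul 2).rexp
    have e2 : Tendsto (fun t => Real.exp (-(2 * γ t))) atTop (𝓝 1) := by
      simpa using (hγlim.const_mul 2).neg.rexp
    have e3 := (tendsto_rpow_mul_exp_neg_mul_atTop_nhds_zero 1 1 one_pos).comp
      (tendsto_log_add_atTop u)
    have e4 := (tendsto_rpow_mul_exp_neg_mul_atTop_nhds_zero 1 c hc0).comp
      (tendsto_log_add_atTop u)
    have := ((((e1.sub ((hγlim.const_sub 1).mul e2)).const_mul (Real.exp (-u))).add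
      (((e1.pow 2).const_mul (Q * Real.exp (-u))).mul e3)).add
      ((e1.const_mul (Q * Real.exp (-u))).mul e4)).add tendsto_inv_atTop_zero
    convert this using 2
    · rfl
    · ring
  rw [tendsto_iff_norm_sub_tendsto_zero]
  refine squeeze_zero' (Eventually.of_forall fun _ => norm_nonneg _) ?_ hFlim
  have hRlim : Tendsto (fun t => 3 * (criticalMass u t / a) ^ (1 / d : ℝ)) atTop (𝓝 0) := by
    have h1 := ((tendsto_criticalMass u).div_const a).rpow_const (p := (1 / d : ℝ))
      (Or.inr (by positivity))
    rw [zero_div, Real.zero_rpow (by positivity)] at h1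
    simpa using h1.const_mul 3
  filter_upwards [h.eventually_criticalMass u, hRlim.eventually_le_const h.δ_pos,
    eventually_ge_atTop 1] with t ⟨ht, hv0, hv⟩ hR ht1
  have hγ0 : 0 < γ t := by positivity
  have hγ1 : γ t ≤ 1 := inv_le_one_of_one_le₀ (one_le_pow₀ ht1)
  have key := abs_measureReal_closePairsEvent_sub_le h hW hμW ht (hη t ht) hv0 hv hγ0 hγ1
    (by positivity) (fun y hy => h.rpow_le_massRadius hd hv0 hv hy)
    (fun y hy => h.massRadius_le_rpow hd hv0 hv hy) hR
  rw [mul_criticalMass ht, mul_exp_neg_log_add ht] at key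
  refine key.trans (le_of_eq ?_)
  have hpow : t * (b * (3 * (criticalMass u t / a) ^ (1 / d : ℝ)) ^ d) =
      Q * (Real.log t + u) := by
    rw [mul_pow, ← Real.rpow_natCast ((criticalMass u t / a) ^ (1 / d : ℝ)),
      ← Real.rpow_mul (by positivity), one_div_mul_cancel hd'.ne', Real.rpow_one,
      ← mul_criticalMass ht, hQ]
    ring
  have hγt : γ t * t = t⁻¹ := by simp only [hγ]; field_simp
  have hexp := mul_exp_neg_log_add (u := u) ht
  rw [hpow, hγt, hF, ← hc]
  simp only [Real.rpow_one]
  generalize Real.log t + u = l at *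
  have hexp1 : Real.exp (-((1 + c) * l) + 2 * γ t) =
      Real.exp (-l) * Real.exp (-c * l) * Real.exp (2 * γ t) := by
    rw [← Real.exp_add, ← Real.exp_add]; congr 1; ring
  rw [hexp1, Real.exp_add, ← hexp, neg_one_mul]
  ring

end Limits

/-- A family of events squeezed between the events at the levels `u - h` and `u + h`, for all
`h > 0`, inherits the limit. -/
theorem tendsto_measureReal_of_sandwich {Ω : Type*} [MeasurableSpace Ω] {P : Measure Ω}
    [IsFiniteMeasure P] {F : ℝ → ℝ → Set Ω} {S : ℝ → Set Ω} {g : ℝ → ℝ} {u : ℝ}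
    (hg : ContinuousAt g u) (hF : ∀ u, Tendsto (fun t => P.real (F u t)) atTop (𝓝 (g u)))
    (hlow : ∀ h > 0, ∀ᶠ t in atTop, F (u - h) t ⊆ S t)
    (hup : ∀ h > 0, ∀ᶠ t in atTop, S t ⊆ F (u + h) t) :
    Tendsto (fun t => P.real (S t)) atTop (𝓝 (g u)) := by
  refine tendsto_order.2 ⟨fun y hy => ?_, fun y hy => ?_⟩
  · have h1 : ∀ᶠ h in 𝓝[>] (0 : ℝ), y < g (u - h) := by
      have h2 : Tendsto (fun h => u - h) (𝓝[>] (0 : ℝ)) (𝓝 u) :=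
        (Continuous.tendsto' (by fun_prop) 0 u (by simp)).mono_left nhdsWithin_le_nhds
      exact (hg.tendsto.comp h2).eventually_const_lt hy
    obtain ⟨h, hh, hh0⟩ := (h1.and self_mem_nhdsWithin).exists
    filter_upwards [hlow h hh0, (hF (u - h)).eventually_const_lt hh] with t ht1 ht2
    exact ht2.trans_le (measureReal_mono ht1)
  · have h1 : ∀ᶠ h in 𝓝[>] (0 : ℝ), g (u + h) < y := by
      have h2 : Tendsto (fun h => u + h) (𝓝[>] (0 : ℝ)) (𝓝 u) :=
        (Continuous.tendsto' (by fun_prop) 0 u (by simp)).mono_left nhdsWithin_le_nhds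
      exact (hg.tendsto.comp h2).eventually_lt_const hy
    obtain ⟨h, hh, hh0⟩ := (h1.and self_mem_nhdsWithin).exists
    filter_upwards [hup h hh0, (hF (u + h)).eventually_lt_const hh] with t ht1 ht2
    exact (measureReal_mono ht1).trans_lt ht2

/-- A functional of the inradii whose value at half the critical radius of level `u` is
`log t + u + o(1)`, uniformly in `W`, has a maximum converging to the Gumbel law. -/
theorem tendsto_measureReal_iSup_inradius_le {d : ℕ} (hd : 1 ≤ d)
    {μ : Measure (EuclideanSpace ℝ (Fin d))} {W : Set (EuclideanSpace ℝ (Fin d))}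
    {δ a b L : ℝ} (h : RegularNear μ W d δ a b L) (hW : IsCompact W) (hμW : μ W = 1)
    {Ω : Type*} [MeasurableSpace Ω] {P : Measure Ω} [IsProbabilityMeasure P]
    {η : ℝ → Ω → Measure (EuclideanSpace ℝ (Fin d))}
    (hη : ∀ t : ℝ, 0 < t → IsPoissonProcess P (ENNReal.ofReal t • μ) (η t))
    {G : ℝ → EuclideanSpace ℝ (Fin d) → ℝ≥0∞ → ℝ≥0∞} (hG : ∀ t x, Monotone (G t x))
    (hGtop : ∀ t x r, G t x (ENNReal.ofReal r) ≠ ∞)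
    (hGlim : ∀ u, ∀ ε > 0, ∀ᶠ t in atTop, ∀ x ∈ W,
      |(G t x (ENNReal.ofReal (massRadius μ (criticalMass u t) x / 2))).toReal
        - (Real.log t + u)| < ε) (u : ℝ) :
    Tendsto (fun t => P.real {ω | (⨆ x ∈ points (η t ω) ∩ W,
        ((G t x (inradius x (η t ω)) : ℝ≥0∞) : EReal) - (Real.log t : EReal)) ≤ (u : EReal)})
      atTop (𝓝 (Real.exp (-Real.exp (-u)))) := by
  refine tendsto_measureReal_of_sandwich
    (F := fun u t => closePairsEvent (η t) W (massRadius μ (criticalMass u t)))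
    (g := fun u => Real.exp (-Real.exp (-u))) (by fun_prop)
    (fun u => tendsto_measureReal_closePairsEvent hd h hW hμW hη u) (fun ε hε => ?_)
    fun ε hε => ?_
  · filter_upwards [hGlim (u - ε) ε hε, (tendsto_log_add_atTop u).eventually_ge_atTop 0]
      with t ht hl
    refine closePairsEvent_subset_iSup_le (hG t) hl fun x hx => ?_
    rw [ENNReal.le_ofReal_iff_toReal_le (hGtop _ _ _) hl]
    linarith [(abs_lt.1 (ht x hx)).2]
  · filter_upwards [hGlim (u + ε) ε hε, (tendsto_log_add_atTop u).eventually_ge_atTop 0]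
      with t ht hl
    refine iSup_le_subset_closePairsEvent (hG t) hl fun x hx => ?_
    rw [ENNReal.ofReal_lt_iff_lt_toReal hl (hGtop _ _ _)]
    linarith [(abs_lt.1 (ht x hx)).1]

theorem mainTheorem8 {d : ℕ} (hd : 1 ≤ d)
    (f : EuclideanSpace ℝ (Fin d) → ℝ≥0) (hf : Measurable f)
    (μ : Measure (EuclideanSpace ℝ (Fin d)))
    (hμ : μ = volume.withDensity (fun x => (f x : ℝ≥0∞)))
    (hμfin : IsLocallyFiniteMeasure μ)
    (W : Set (EuclideanSpace ℝ (Fin d))) (hW : IsCompact W) (hμW : μ W = 1)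
    (hA : ∃ A : Set (EuclideanSpace ℝ (Fin d)), IsOpen A ∧ Bornology.IsBounded A ∧ W ⊆ A ∧
      (∃ fmin : ℝ≥0, 0 < fmin ∧ ∀ x ∈ A, fmin ≤ f x) ∧ (∃ fmax : ℝ≥0, ∀ x ∈ A, f x ≤ fmax))
    {Ω : Type*} [MeasurableSpace Ω] (P : Measure Ω) [IsProbabilityMeasure P]
    (η : ℝ → Ω → Measure (EuclideanSpace ℝ (Fin d)))
    (hη : ∀ t : ℝ, 0 < t → IsPoissonProcess P (ENNReal.ofReal t • μ) (η t)) :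
    (∀ u : ℝ, Tendsto (fun t : ℝ => P.real {ω | maxInradius μ W t (η t ω) ≤ (u : EReal)})
      atTop (𝓝 (Real.exp (-Real.exp (-u))))) ∧
    ((∃ C b : ℝ≥0, 0 < b ∧ HolderWith C b f) →
      ∀ u : ℝ, Tendsto (fun t : ℝ => P.real {ω | maxInradiusHat μ W t (η t ω) ≤ (u : EReal)})
        atTop (𝓝 (Real.exp (-Real.exp (-u))))) := by
  obtain ⟨A, hAo, -, hWA, ⟨fmin, hmin0, hmin⟩, fmax, hmax⟩ := hA
  have hWne : W.Nonempty := nonempty_of_measure_ne_zero (by rw [hμW]; exact one_ne_zero)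
  obtain ⟨δ, a, b, L, h⟩ := exists_regularNear hd hf hμ hμfin hW hWne hAo hWA hmin0 hmin hmax
  refine ⟨fun u => ?_, ?_⟩
  · have h2 : ∀ r : ℝ, (2 : ℝ≥0∞) * ENNReal.ofReal r = ENNReal.ofReal (2 * r) := fun r => by
      rw [ENNReal.ofReal_mul zero_le_two, ENNReal.ofReal_ofNat]
    refine tendsto_measureReal_iSup_inradius_le hd h hW hμW hη
      (G := fun t x c => ENNReal.ofReal t * μ (Metric.eball x (2 * c))) (fun t x c c' hc => ?_)
      (fun t x r => ?_) (fun u ε hε => ?_) u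
    · dsimp only; gcongr
    · rw [h2, Metric.eball_ofReal]
      exact ENNReal.mul_ne_top ENNReal.ofReal_ne_top (h.finite _ _)
    · filter_upwards [h.eventually_criticalMass u] with t ⟨ht, hv0, hv⟩ x hx
      rw [h2, mul_div_cancel₀ _ two_ne_zero, Metric.eball_ofReal, ENNReal.toReal_mul,
        ENNReal.toReal_ofReal ht.le,
        ← measureReal_def, h.measureReal_ball_massRadius hv0 hv hx, mul_criticalMass ht, sub_self,
        abs_zero]
      exact hε
  · rintro ⟨C, β, hβ, hH⟩ u
    refine tendsto_measureReal_iSup_inradius_le hd h hW hμW hη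
      (G := fun t x c => 2 ^ d * ENNReal.ofReal t * μ (Metric.eball x c)) (fun t x c c' hc => ?_)
      (fun t x r => ?_) (fun u ε hε => ?_) u
    · dsimp only; gcongr
    · rw [Metric.eball_ofReal]
      exact ENNReal.mul_ne_top (ENNReal.mul_ne_top (by simp) ENNReal.ofReal_ne_top) (h.finite _ _)
    · have ha := h.a_pos
      have hd' : (0 : ℝ) < d := by exact_mod_cast hd
      have hβ' : (0 : ℝ) < β := hβ
      set κ := volume.real (Metric.ball (0 : EuclideanSpace ℝ (Fin d)) 1) with hκ
      have hκ0 : 0 < κ := volume_real_unitBall_pos d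
      have hlim := (tendsto_mul_criticalMass_rpow u (show 0 < (β : ℝ) / d by positivity)).const_mul
        (2 * C * κ / a / a ^ ((β : ℝ) / d))
      rw [mul_zero] at hlim
      filter_upwards [h.eventually_criticalMass u, hlim.eventually_lt_const hε]
        with t ⟨ht, hv0, hv⟩ hlt x hx
      set v := criticalMass u t with hvdef
      set r := massRadius μ v x with hrdef
      have hr0 : 0 ≤ r := massRadius_nonneg _ _ _
      have hball := hH.abs_two_pow_mul_withDensity_ball_sub_le hd hf hμ h.finite x hr0
      rw [h.measureReal_ball_massRadius hv0 hv hx, ← hκ] at hball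
      rw [Metric.eball_ofReal, ENNReal.toReal_mul, ENNReal.toReal_mul, ENNReal.toReal_ofReal ht.le,
        ← measureReal_def, ENNReal.toReal_pow, ENNReal.toReal_ofNat, ← mul_criticalMass ht]
      have hrd : r ^ d ≤ v / a := by
        rw [le_div_iff₀' ha]; exact h.mul_massRadius_pow_le hv0 hv hx
      have hrβ : r ^ (β : ℝ) ≤ v ^ ((β : ℝ) / d) / a ^ ((β : ℝ) / d) := by
        rw [← Real.div_rpow hv0.le ha.le]
        calc r ^ (β : ℝ) ≤ ((v / a) ^ (1 / d : ℝ)) ^ (β : ℝ) := by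
              gcongr; exact h.massRadius_le_rpow hd hv0 hv hx
          _ = _ := by rw [← Real.rpow_mul (by positivity)]; congr 1; ring
      calc |2 ^ d * t * μ.real (Metric.ball x (r / 2)) - t * v|
          = t * |2 ^ d * μ.real (Metric.ball x (r / 2)) - v| := by
            rw [← abs_of_pos ht, ← abs_mul, abs_of_pos ht]; congr 1; ring
        _ ≤ t * (2 * (C * r ^ (β : ℝ)) * κ * r ^ d) := by gcongr
        _ ≤ t * (2 * (C * (v ^ ((β : ℝ) / d) / a ^ ((β : ℝ) / d))) * κ * (v / a)) := by gcongr
        _ = 2 * C * κ / a / a ^ ((β : ℝ) / d) * ((t * v) * v ^ ((β : ℝ) / d)) := by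
            field_simp
        _ < ε := by rw [mul_criticalMass ht]; exact hlt
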